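/- Let $\mathfrak H=\{\tau\in\mathbb C:\operatorname{Im}\tau>0\}$, let $E_4,E_6$ be the normalized Eisenstein series of weights $4,6$ for $SL_2(\mathbb Z)$, $\eta$ the Dedekind eta-function, $\Delta=\eta^{24}$, $J=E_4^3/(1728\,\Delta)$, and $\rho=e^{2\pi i/3}$. Let $n\ge 0$ be an integer and let $(x_1,\dots,x_n)\in(0,1)^n$ be a solution, with pairwise distinct $x_i$, of the system $E^n_{8,9,12}$: $$\frac{8}{x_i}+\frac{9}{x_i-1}+\sum_{j\ne i}\frac{12}{x_i-x_j}=0,\qquad 1\le i\le n.$$ Let $w_i\in\mathfrak H$ with $J(w_i)=x_i$, and put $$f_n=\frac{\eta^{44}}{E_4^2E_6^2\prod_{i=1}^n(J-x_i)^2}=\frac{1}{1728}\cdot\frac{\eta^{20}}{E_4^2\,(J-1)\prod_{i=1}^n(J-x_i)^2}.$$ Then: 1. $f_n$ is a meromorphic modular form of weight $2$ for $SL_2(\mathbb Z)$ with a character: it is meromorphic on $\mathfrak H$ and at the cusp (a meromorphic function near $0$ of $e^{2\pi i\tau/N}$ for some $N\ge1$), and $f_n(\gamma\tau)=\chi(\gamma)(c\tau+d)^2f_n(\tau)$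 for all $\gamma=\begin{pmatrix}a&b\\c&d\end{pmatrix}\in SL_2(\mathbb Z)$, for some homomorphism $\chi:SL_2(\mathbb Z)\to\mathbb C^\times$. 2. $f_n$ has a double pole with zero residue at $i$, at $\rho$, at each $w_i$, and at every point of the $SL_2(\mathbb Z)$-orbits of these points; at all other points of $\mathfrak H$ it is holomorphic and nonvanishing. 3. $f_n$ has an integral on $\mathfrak H$, i.e. there is a (single-valued) meromorphic function $h_n$ on $\mathfrak H$ with $h_n'=f_n$ away from the poles of $f_n$; and every such $h_n$ satisfies $$\{h_n,\tau\}=2\pi^2\left(\frac{12n+11}{6}\right)^2E_4(\tau),\qquad\text{where } \{h,\tau\}=\left(\frac{h''}{h'}\right)'-\frac12\left(\frac{h''}{h'}\right)^2 .$$ The identity holds at every point of $\mathfrak H$ that is not a pole of $f_n$, and $\{h_n,\tau\}$ extends holomorphically across the poles with the same identity. -/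

import Mathlib

open Filter Topology MatrixGroups UpperHalfPlane

noncomputable section

namespace ModularODE

/-- The modular invariant `J = E₄³ / (1728 Δ)`, with `Δ = η²⁴` (so that `J(i) = 1`, `J(ρ) = 0`). -/
def kleinJ (τ : ℍ) : ℂ :=
  ModularForm.E₄ τ ^ 3 / (1728 * ModularForm.discriminant τ)

/-- `x` is a solution of the algebraic system
`a / xᵢ + b / (xᵢ - 1) + ∑_{j ≠ i} c / (xᵢ - xⱼ) = 0`, `1 ≤ i ≤ n`.
Being a solution includes that no denominator vanishes. -/
structure IsSolution {n : ℕ} (a b c : ℝ) (x : Fin n → ℝ) : Prop where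
  injective : Function.Injective x
  ne_zero : ∀ i, x i ≠ 0
  ne_one : ∀ i, x i ≠ 1
  eq_zero : ∀ i, a / x i + b / (x i - 1) + ∑ j ∈ Finset.univ.erase i, c / (x i - x j) = 0

/-- The function `η⁴⁴ / (E₄² E₆² ∏ᵢ (J - xᵢ)²)` on the upper half-plane
(with value `0` at the zeros of the denominator). -/
def fForm {n : ℕ} (x : Fin n → ℝ) (τ : ℍ) : ℂ :=
  ModularForm.eta τ ^ 44 /
    (ModularForm.E₄ τ ^ 2 * ModularForm.E₆ τ ^ 2 * ∏ i, (kleinJ τ - (x i : ℂ)) ^ 2)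

/-- `f` is a meromorphic modular form of weight `k` for `SL(2, ℤ)` with character `χ`:
it is meromorphic on the upper half-plane, satisfies
`f((aτ + b) / (cτ + d)) = χ(γ) (cτ + d)ᵏ f(τ)`, and is meromorphic at the cusp, that is, for
large `Im τ` it is a meromorphic function, near `0`, of `q_N = exp(2πiτ / N)` for some `N ≥ 1`.
(The set of poles being invariant, the transformation law is also meaningful there when all
poles carry the same conventional value `0`.) -/
structure IsMeromorphicModularForm (k : ℤ) (χ : SL(2, ℤ) →* ℂˣ) (f : ℍ → ℂ) : Prop where
  meromorphic : ∀ τ : ℍ, MeromorphicAt (f ∘ ofComplex) (τ : ℂ)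
  transform : ∀ (γ : SL(2, ℤ)) (τ : ℍ),
    f (γ • τ) = (χ γ : ℂ) * (((γ 1 0 : ℤ) : ℂ) * (τ : ℂ) + ((γ 1 1 : ℤ) : ℂ)) ^ k * f τ
  meromorphic_at_cusp : ∃ N : ℕ, 0 < N ∧ ∃ F : ℂ → ℂ, MeromorphicAt F 0 ∧
    ∀ᶠ τ : ℍ in atImInfty, f τ = F (Complex.exp (2 * Real.pi * Complex.I * (τ : ℂ) / N))

/-- `F` (with at most an isolated singularity at `a`) has residue `c` at `a`:
`(1 / 2πi) ∮_{|z - a| = r} F(z) dz = c` for all sufficiently small `r > 0`. -/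
def HasResidueAt (F : ℂ → ℂ) (a c : ℂ) : Prop :=
  ∀ᶠ r : ℝ in 𝓝[>] 0, CircleIntegrable F a r ∧
    (2 * Real.pi * Complex.I)⁻¹ * (∮ z in C(a, r), F z) = c

/-- `F` has a double pole with zero residue at `a`. -/
def HasDoublePoleZeroResidueAt (F : ℂ → ℂ) (a : ℂ) : Prop :=
  MeromorphicAt F a ∧ meromorphicOrderAt F a = ((-2 : ℤ) : WithTop ℤ) ∧ HasResidueAt F a 0

/-- The `SL(2, ℤ)`-orbits of `i`, of `ρ = exp(2πi / 3)` and of the points `wᵢ`. -/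
def poleSet {n : ℕ} (w : Fin n → ℍ) : Set ℍ :=
  MulAction.orbit SL(2, ℤ) UpperHalfPlane.I ∪ MulAction.orbit SL(2, ℤ) UpperHalfPlane.ρ ∪
    ⋃ i, MulAction.orbit SL(2, ℤ) (w i)

/-- `h` is an integral (primitive) of `F` on the upper half-plane: it is a (single-valued)
meromorphic function there, and `h' = F` wherever `F` is holomorphic. -/
def IsIntegralOf (h F : ℂ → ℂ) : Prop :=
  MeromorphicOn h upperHalfPlaneSet ∧
    ∀ z ∈ upperHalfPlaneSet, AnalyticAt ℂ F z → HasDerivAt h (F z) z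

/-- The Schwarz derivative `{h, τ} = (h'' / h')' - (1 / 2) (h'' / h')²`. -/
def schwarzian (h : ℂ → ℂ) (z : ℂ) : ℂ :=
  deriv (fun u => deriv (deriv h) u / deriv h u) z
    - 1 / 2 * (deriv (deriv h) z / deriv h z) ^ 2

end ModularODE

end

/-!
The form `fₙ` is `u⁻²` for the weight `-1` form `u = E₄ E₆ ∏ (J - xᵢ) / η²²`. By the classical
observation of Heine and Stieltjes, the algebraic system says that `p = ∏ (X - xᵢ)` solves a
hypergeometric differential equation. Through Ramanujan's formulas for the derivatives of `E₂`,
`E₄`, `E₆` and `η`, this becomes `u'' = Q u` with `Q = -4π² ((12n + 11) / 12)² E₄`, so every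
primitive of `u⁻²` has Schwarzian derivative `-2Q`.

The Serre derivative of `u` is `1728 η² R(J)` for a polynomial `R` coprime to `X (X - 1) p`; hence
`u` has simple zeros, and a Bézout relation writes `u⁻²` as the derivative of a meromorphic function
plus a holomorphic function. A primitive therefore exists on the upper half-plane, and all residues
vanish. The zeros of `u` are the points where `J ∈ {0, 1, x₁, …, xₙ}`; that `J` separates orbits
holds because the Weierstrass function, hence the lattice, is determined by `g₂` and `g₃`.
-/

noncomputable section

namespace ModularODE

open ModularForm EisensteinSeries Derivative Function
open scoped Manifold

section Ramanujan

lemma tendsto_atImInfty_of_hasSum_qExpansion {h : ℝ} (hh : 0 < h) {F : ℍ → ℂ} {c : ℕ → ℂ}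
    (hc : ∀ τ : ℍ, HasSum (fun m ↦ c m * Periodic.qParam h τ ^ m) (F τ)) :
    Tendsto F atImInfty (𝓝 (c 0)) := by
  have hq := qParam_tendsto_atImInfty hh
  have hsmall : ∀ᶠ τ : ℍ in atImInfty, ‖Periodic.qParam h τ‖ < ‖Periodic.qParam h I‖ :=
    (tendsto_zero_iff_norm_tendsto_zero.mp hq).eventually_lt_const
      (norm_pos_iff.mpr (Periodic.qParam_ne_zero _))
  have hterm : ∀ m, Tendsto (fun τ : ℍ ↦ c m * Periodic.qParam h τ ^ m) atImInfty
      (𝓝 (c m * 0 ^ m)) := fun m ↦ (hq.pow m).const_mul (c m)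
  have hlim := tendsto_tsum_of_dominated_convergence (hc I).summable.norm hterm (by
    filter_upwards [hsmall] with τ hτ m
    simp only [norm_mul, norm_pow]
    gcongr)
  have h0 : ∑' m, c m * (0 : ℂ) ^ m = c 0 :=
    (tsum_eq_single 0 fun m hm ↦ by simp [hm]).trans (by simp)
  rw [h0] at hlim
  exact hlim.congr fun τ ↦ (hc τ).tsum_eq

lemma tendsto_normalizedDerivOfComplex_atImInfty {F : ℍ → ℂ} (hF : MDiff F) {a : ℂ}
    (ha : Tendsto F atImInfty (𝓝 a)) :
    Tendsto (normalizedDerivOfComplex F) atImInfty (𝓝 0) := by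
  have hderiv : Tendsto (fun τ : ℍ ↦ deriv (F ∘ ofComplex) τ) atImInfty (𝓝 0) := by
    rw [Metric.tendsto_nhds] at ha ⊢
    intro ε hε
    obtain ⟨A, hA⟩ := (atImInfty_mem _).mp (ha (ε / 2) (by positivity))
    refine (atImInfty_mem _).mpr ⟨max A 0 + 2, fun τ hτ ↦ ?_⟩
    have him : ∀ z ∈ Metric.closedBall (τ : ℂ) 1, max A 0 < z.im := fun z hz ↦ by
      have h1 := (Complex.abs_im_le_norm (z - τ)).trans (mem_closedBall_iff_norm.mp hz)
      have h2 := abs_le.mp h1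
      simp only [Complex.sub_im, coe_im] at h2
      linarith
    have hd : DifferentiableOn ℂ (fun z ↦ (F ∘ ofComplex) z - a) (Metric.closedBall (τ : ℂ) 1) :=
      ((UpperHalfPlane.mdifferentiable_iff.mp hF).mono fun z hz ↦
        (le_max_right A 0).trans_lt (him z hz)).sub_const a
    have hbound : ∀ z ∈ Metric.sphere (τ : ℂ) 1, ‖(F ∘ ofComplex) z - a‖ ≤ ε / 2 := by
      intro z hz
      have hz' := him z (Metric.sphere_subset_closedBall hz)
      have hz0 : 0 < z.im := (le_max_right A 0).trans_lt hz'
      have := hA ⟨z, hz0⟩ ((le_max_left A 0).trans hz'.le)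
      rw [Set.mem_ofPred_eq, dist_eq_norm] at this
      simpa [ofComplex_apply_of_im_pos hz0] using this.le
    have hcauchy := Complex.norm_deriv_le_of_forall_mem_sphere_norm_le one_pos
      (hd.diffContOnCl_ball subset_rfl) hbound
    rw [deriv_sub_const] at hcauchy
    simpa using hcauchy.trans_lt (by linarith)
  simpa only [mul_zero] using! hderiv.const_mul (2 * Real.pi * Complex.I)⁻¹

lemma tendsto_E {k : ℕ} (hk : 3 ≤ k) (hk2 : Even k) : Tendsto (E hk) atImInfty (𝓝 1) := by
  have h := tendsto_atImInfty_of_hasSum_qExpansion one_pos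
    (ModularForm.hasSum_qExpansion (E hk) one_pos one_mem_strictPeriods_SL)
  rwa [E_qExpansion_coeff_zero hk hk2] at h

lemma tendsto_E2 : Tendsto E2 atImInfty (𝓝 1) := by
  have h := tendsto_atImInfty_of_hasSum_qExpansion one_pos fun τ ↦ by
    simpa only [Periodic.qParam, Complex.ofReal_one, div_one, smul_eq_mul] using
      hasSum_qExpansion_E2 (z := τ)
  simpa only [if_true] using h

lemma tendsto_serreDerivative {F : ℍ → ℂ} (hF : MDiff F) (k : ℂ) {a : ℂ}
    (ha : Tendsto F atImInfty (𝓝 a)) :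
    Tendsto (serreDerivative k F) atImInfty (𝓝 (-k / 12 * a)) := by
  convert! (tendsto_normalizedDerivOfComplex_atImInfty hF ha).sub
    ((tendsto_E2.const_mul (k * 12⁻¹)).mul ha) using 2
  ring

lemma exists_modularForm_coe_eq {k : ℤ} {F : ℍ → ℂ} (hF : MDiff F)
    (hslash : ∀ γ : SL(2, ℤ), F ∣[k] γ = F) (hbdd : IsBoundedAtImInfty F) :
    ∃ f : ModularForm 𝒮ℒ k, ⇑f = F := by
  refine ⟨{ toFun := F, slash_action_eq' := ?_, holo' := hF, bdd_at_cusps' := ?_ }, rfl⟩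
  · rintro _ ⟨γ, rfl⟩
    exact hslash γ
  · intro c hc
    rw [Subgroup.IsArithmetic.isCusp_iff_isCusp_SL2Z] at hc
    rw [OnePoint.isBoundedAt_iff_forall_SL2Z hc]
    intro γ _
    rwa [hslash]

lemma eq_smul_E_of_slash_invariant {k : ℕ} (hk : 3 ≤ k) (hk2 : Even k) (hk12 : k < 12)
    {F : ℍ → ℂ} (hF : MDiff F) (hslash : ∀ γ : SL(2, ℤ), F ∣[(k : ℤ)] γ = F) {c : ℂ}
    (hc : Tendsto F atImInfty (𝓝 c)) : F = c • ⇑(E hk) := by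
  obtain ⟨f, rfl⟩ := exists_modularForm_coe_eq hF hslash (hc.isBigO_one ℝ)
  have hrank : Module.rank ℂ (ModularForm 𝒮ℒ k) = 1 := by
    rw [ModularForm.rank_eq_one_add_rank_cuspForm hk hk2,
      CuspForm.rank_eq_zero_of_weight_lt_twelve (by exact_mod_cast hk12), add_zero]
  obtain ⟨a, rfl⟩ := (finrank_eq_one_iff_of_nonzero' _ (E_ne_zero hk hk2)).mp
    (Module.rank_eq_one_iff_finrank_eq_one.mp hrank) f
  have hac : c = a * 1 := tendsto_nhds_unique hc ((tendsto_E hk hk2).const_mul a)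
  rw [hac, mul_one]
  rfl

lemma modularForm_slash {k : ℤ} (f : ModularForm 𝒮ℒ k) (γ : SL(2, ℤ)) : ⇑f ∣[k] γ = f :=
  SlashInvariantFormClass.slash_action_eq f _ ⟨γ, rfl⟩

lemma serreDerivative_E₄ : serreDerivative 4 E₄ = (-1 / 3 : ℂ) • ⇑E₆ := by
  convert! eq_smul_E_of_slash_invariant (k := 6) (by norm_num) (by decide) (by norm_num)
    (serreDerivative_mdifferentiable 4 E₄.holo')
    (fun γ ↦ by exact_mod_cast serreDerivative_slash_invariant E₄.holo' (modularForm_slash E₄ γ))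
    (tendsto_serreDerivative E₄.holo' 4 (tendsto_E _ (by decide))) using 2
  norm_num

lemma serreDerivative_E₆ : serreDerivative 6 E₆ = (-1 / 2 : ℂ) • (⇑E₄ * ⇑E₄) := by
  have h4 := tendsto_E (k := 4) (by norm_num) (by decide)
  rw [eq_smul_E_of_slash_invariant (k := 8) (F := E₄ * E₄) (by norm_num) (by decide)
    (by norm_num) (E₄.holo'.mul E₄.holo')
    (fun γ ↦ by
      have := ModularForm.mul_slash_SL2 4 4 γ E₄ E₄
      rw [modularForm_slash] at this
      exact_mod_cast this) (by simpa using! h4.mul h4)]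
  convert! eq_smul_E_of_slash_invariant (k := 8) (by norm_num) (by decide) (by norm_num)
    (serreDerivative_mdifferentiable 6 E₆.holo')
    (fun γ ↦ by exact_mod_cast serreDerivative_slash_invariant E₆.holo' (modularForm_slash E₆ γ))
    (tendsto_serreDerivative E₆.holo' 6 (tendsto_E _ (by decide))) using 1
  rw [smul_smul]
  norm_num

lemma hasDerivAt_D2 (γ : SL(2, ℤ)) (τ : ℍ) :
    HasDerivAt (D2 γ ∘ ofComplex) (-(2 * Real.pi * Complex.I * (γ 1 0 / denom γ τ) ^ 2)) τ := by
  have h := (hasDerivAt_denom_zpow (γ : GL (Fin 2) ℝ) (-1) τ).const_mul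
    (2 * Real.pi * Complex.I * (γ 1 0 : ℂ))
  refine (h.congr_of_eventuallyEq ?_).congr_deriv ?_
  · filter_upwards [isOpen_upperHalfPlaneSet.mem_nhds τ.im_pos] with z hz
    simp [D2, ofComplex_apply_of_im_pos hz, div_eq_mul_inv]
  · have hcast : (((γ : GL (Fin 2) ℝ) 1 0 : ℝ) : ℂ) = γ 1 0 := by simp
    rw [hcast]
    norm_num
    ring

lemma mdifferentiable_D2 (γ : SL(2, ℤ)) : MDiff (D2 γ) := fun τ ↦
  mdifferentiableAt_iff.mpr (hasDerivAt_D2 γ τ).differentiableAt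

/-- The defect `β` of invariance of `E₂`, namely `β = E₂ - E₂ ∣[2] γ`. -/
def E2Defect (γ : SL(2, ℤ)) : ℍ → ℂ := (1 / (2 * riemannZeta 2)) • D2 γ

lemma E2Defect_apply (γ : SL(2, ℤ)) (τ : ℍ) :
    E2Defect γ τ = 12 * (2 * Real.pi * Complex.I)⁻¹ * -(γ 1 0 / denom γ τ) := by
  have hpi : (Real.pi : ℂ) ≠ 0 := mod_cast Real.pi_ne_zero
  have hd := denom_ne_zero (γ : GL (Fin 2) ℝ) τ
  simp only [E2Defect, Pi.smul_apply, D2, riemannZeta_two, smul_eq_mul]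
  field_simp
  linear_combination 12 * (γ 1 0 : ℂ) * Complex.I_sq

lemma normalizedDerivOfComplex_E2Defect (γ : SL(2, ℤ)) (τ : ℍ) :
    normalizedDerivOfComplex (E2Defect γ) τ = E2Defect γ τ ^ 2 / 12 := by
  rw [E2Defect_apply, E2Defect, normalizedDerivOfComplex_smul _ _ (mdifferentiable_D2 γ),
    Pi.smul_apply, normalizedDerivOfComplex, (hasDerivAt_D2 γ τ).deriv, smul_eq_mul,
    riemannZeta_two]
  field_simp [Complex.two_pi_I_ne_zero]
  linear_combination -12 * (γ 1 0 : ℂ) ^ 2 * Complex.I_sq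

lemma normalizedDerivOfComplex_E2_slash (γ : SL(2, ℤ)) (τ : ℍ) :
    (normalizedDerivOfComplex E2 ∣[(4 : ℤ)] γ) τ = normalizedDerivOfComplex E2 τ -
      E2Defect γ τ ^ 2 / 12 - E2Defect γ τ / 6 * (E2 τ - E2Defect γ τ) := by
  have h := congrFun (normalizedDerivOfComplex_SL_slash (k := 2) E2_mdifferentiable (γ := γ)) τ
  have hE2 : E2 ∣[(2 : ℤ)] γ = E2 - E2Defect γ := E2_slash_action γ
  rw [hE2, normalizedDerivOfComplex_sub _ (E2Defect γ) E2_mdifferentiable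
    ((mdifferentiable_D2 γ).const_smul _), Pi.sub_apply, Pi.sub_apply,
    normalizedDerivOfComplex_E2Defect, Pi.sub_apply] at h
  push_cast at h
  linear_combination -h + (E2 τ - E2Defect γ τ) / 6 * E2Defect_apply γ τ

lemma serreDerivative_one_E2_slash (γ : SL(2, ℤ)) :
    serreDerivative 1 E2 ∣[(4 : ℤ)] γ = serreDerivative 1 E2 := by
  ext τ
  have hsq : ((E2 * E2) ∣[(4 : ℤ)] γ) τ = (E2 τ - E2Defect γ τ) ^ 2 := by
    have h := congrFun (ModularForm.mul_slash_SL2 2 2 γ E2 E2) τ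
    rw [E2_slash_action γ] at h
    exact h.trans (sq _).symm
  have hD := normalizedDerivOfComplex_E2_slash γ τ
  rw [SL_slash_apply] at hsq hD ⊢
  rw [Pi.mul_apply] at hsq
  rw [serreDerivative_apply, serreDerivative_apply]
  linear_combination hD - hsq / 12

lemma serreDerivative_one_E2 : serreDerivative 1 E2 = (-1 / 12 : ℂ) • ⇑E₄ := by
  convert! eq_smul_E_of_slash_invariant (k := 4) (by norm_num) (by decide) (by norm_num)
    (serreDerivative_mdifferentiable 1 E2_mdifferentiable) serreDerivative_one_E2_slash
    (tendsto_serreDerivative E2_mdifferentiable 1 tendsto_E2) using 2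
  norm_num

end Ramanujan

section Stieltjes

open Polynomial

/-- The monic polynomial `∏ (X - xᵢ)`, whose differential equation encodes the system
`E_{a,b,c}` satisfied by its roots. -/
def rootPoly {n : ℕ} (x : Fin n → ℝ) : ℝ[X] := ∏ i, (X - C (x i))

variable {n : ℕ} {x : Fin n → ℝ} {a b c : ℝ}

lemma aeval_rootPoly (x : Fin n → ℝ) (t : ℂ) : aeval t (rootPoly x) = ∏ i, (t - x i) := by
  simp [rootPoly, map_prod]

lemma natDegree_rootPoly (x : Fin n → ℝ) : (rootPoly x).natDegree = n := by
  simp [rootPoly, natDegree_finsetProd_X_sub_C_eq_card]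

lemma eval_rootPoly_self (x : Fin n → ℝ) (i : Fin n) : (rootPoly x).eval (x i) = 0 := by
  rw [rootPoly, eval_prod]
  exact Finset.prod_eq_zero (Finset.mem_univ i) (by simp)

lemma eval_derivative_derivative_rootPoly (hx : Injective x) (i : Fin n) :
    (derivative (derivative (rootPoly x))).eval (x i) =
      2 * (∑ j ∈ Finset.univ.erase i, 1 / (x i - x j)) * (derivative (rootPoly x)).eval (x i) := by
  set s := Finset.univ.erase i
  set q : ℝ[X] := ∏ j ∈ s, (X - C (x j)) with hq
  have hfactor : rootPoly x = (X - C (x i)) * q :=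
    (Finset.mul_prod_erase _ _ (Finset.mem_univ i)).symm
  have hq_ne : q.eval (x i) ≠ 0 := by
    rw [hq, eval_prod, Finset.prod_ne_zero_iff]
    intro j hj
    simpa [sub_eq_zero] using hx.ne (Finset.ne_of_mem_erase hj).symm
  have hq_roots : q.roots = s.val.map x := by
    rw [hq, roots_prod _ _ (Finset.prod_ne_zero_iff.mpr fun j _ ↦ X_sub_C_ne_zero (x j))]
    simp only [roots_X_sub_C, Multiset.bind_singleton]
  have hq' : (derivative q).eval (x i) = q.eval (x i) * ∑ j ∈ s, 1 / (x i - x j) := by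
    rw [(Splits.prod fun j _ ↦ Splits.X_sub_C (x j)).eval_derivative_eq_eval_mul_sum hq_ne,
      hq_roots, Multiset.map_map]
    rfl
  rw [hfactor]
  simp only [derivative_mul, derivative_sub, derivative_X, derivative_C, sub_zero, one_mul,
    derivative_add, eval_add, eval_mul, eval_sub, eval_X, eval_C, sub_self, zero_mul, add_zero,
    hq']
  ring

lemma coeff_hypergeometric {R : Type*} [CommRing R] (p : R[X]) (α β : R) (m : ℕ) :
    (X * (X - 1) * derivative (derivative p) + (C α * X - C β) * derivative p).coeff m =
      m * (m - 1 + α) * p.coeff m - (m + 1) * (m + β) * p.coeff (m + 1) := by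
  have hexpand : X * (X - 1) * derivative (derivative p) + (C α * X - C β) * derivative p =
      X * (X * derivative (derivative p)) - X * derivative (derivative p) +
        C α * (X * derivative p) - C β * derivative p := by ring
  rw [hexpand]
  rcases m with _ | _ | m <;>
    simp only [coeff_add, coeff_sub, coeff_C_mul, coeff_X_mul, mul_coeff_zero, coeff_X_zero,
      coeff_C_zero, coeff_derivative] <;>
    push_cast <;> ring

/-- The two sides have the same coefficient of `Xⁿ`, and at the root `xᵢ` their difference is a
multiple of the `i`-th equation of the system, because `p'' = 2 p' ∑ 1 / (xᵢ - xⱼ)` there. -/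
lemma rootPoly_ode (hc : c ≠ 0) (hx : IsSolution a b c x) :
    X * (X - 1) * derivative (derivative (rootPoly x)) +
      (C (2 * (a + b) / c) * X - C (2 * a / c)) * derivative (rootPoly x) =
        C (n * (n - 1 + 2 * (a + b) / c)) * rootPoly x := by
  rw [← sub_eq_zero]
  refine eq_zero_of_degree_lt_of_eval_finset_eq_zero (Finset.univ.map ⟨x, hx.injective⟩) ?_ ?_
  · rw [Finset.card_map, Finset.card_univ, Fintype.card_fin, degree_lt_iff_coeff_zero]
    intro m hm
    have hcoeff : ∀ k, n < k → (rootPoly x).coeff k = 0 := fun k hk ↦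
      coeff_eq_zero_of_natDegree_lt (by rwa [natDegree_rootPoly])
    rw [coeff_sub, coeff_hypergeometric, coeff_C_mul, hcoeff (m + 1) (by omega)]
    rcases hm.eq_or_lt with rfl | hm
    · ring
    · rw [hcoeff m hm]
      ring
  · intro t ht
    obtain ⟨i, -, rfl⟩ := Finset.mem_map.mp ht
    have h0 := hx.ne_zero i
    have h1 := sub_ne_zero.mpr (hx.ne_one i)
    have hsys := hx.eq_zero i
    have hsum : ∑ j ∈ Finset.univ.erase i, c / (x i - x j) =
        c * ∑ j ∈ Finset.univ.erase i, 1 / (x i - x j) := by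
      rw [Finset.mul_sum]
      exact Finset.sum_congr rfl fun _ _ ↦ (mul_one_div _ _).symm
    rw [hsum] at hsys
    simp only [Function.Embedding.coeFn_mk, eval_sub, eval_add, eval_mul, eval_X, eval_C, eval_one,
      eval_rootPoly_self, eval_derivative_derivative_rootPoly hx.injective i]
    field_simp at hsys ⊢
    linear_combination 2 * (derivative (rootPoly x)).eval (x i) * hsys

/-- The polynomial `R` for which the Serre derivative of the weight `-1` form
`E₄ E₆ ∏ (J - xᵢ) / η²²` is `1728 η² R(J)`. -/
def serrePoly {n : ℕ} (x : Fin n → ℝ) : ℝ[X] :=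
  -(C (5 / 6) * X - C (1 / 3)) * rootPoly x - X * (X - 1) * derivative (rootPoly x)

lemma derivative_serrePoly (hx : IsSolution 8 9 12 x) :
    derivative (serrePoly x) = C (1 / 144 - ((12 * (n : ℝ) + 11) / 12) ^ 2) * rootPoly x := by
  have hode := rootPoly_ode (by norm_num) hx
  have hC : C (1 / 144 - ((12 * (n : ℝ) + 11) / 12) ^ 2) =
      -C (5 / 6) - C (n * (n - 1 + 2 * (8 + 9) / 12) : ℝ) := by
    rw [← C_neg, ← C_sub]
    congr 1
    ring
  have hα : (C (2 * (8 + 9) / 12) : ℝ[X]) = C (5 / 6) + 2 := by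
    rw [← C_ofNat, ← C_add]
    norm_num
  have hβ : (C (2 * 8 / 12) : ℝ[X]) = C (1 / 3) + 1 := by
    rw [← C_1, ← C_add]
    norm_num
  rw [hα, hβ] at hode
  rw [hC]
  simp only [serrePoly, derivative_sub, derivative_mul, derivative_neg, derivative_X, derivative_C,
    derivative_one]
  linear_combination -hode

lemma eval_derivative_rootPoly_ne_zero (hx : Injective x) (i : Fin n) :
    (derivative (rootPoly x)).eval (x i) ≠ 0 := by
  have hsep : (rootPoly x).Separable := separable_prod_X_sub_C_iff.mpr hx
  simpa using hsep.eval₂_derivative_ne_zero (RingHom.id ℝ) (x := x i)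
    (by simpa using eval_rootPoly_self x i)

lemma isCoprime_X_sub_C_iff {K : Type*} [Field K] {t : K} {q : K[X]} :
    IsCoprime (X - C t) q ↔ q.eval t ≠ 0 := by
  rw [(irreducible_X_sub_C t).coprime_iff_not_dvd, dvd_iff_isRoot, IsRoot.def]

lemma isCoprime_serrePoly (hx : IsSolution a b c x) :
    IsCoprime (X * (X - 1) * rootPoly x) (serrePoly x) := by
  have hp : ∀ t, (∀ i, x i ≠ t) → (rootPoly x).eval t ≠ 0 := fun t ht ↦ by
    rw [rootPoly, eval_prod, Finset.prod_ne_zero_iff]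
    intro i _
    simpa [sub_eq_zero] using (ht i).symm
  refine (IsCoprime.mul_left ?_ ?_).mul_left (IsCoprime.prod_left fun i _ ↦ ?_)
  · rw [← sub_zero X, ← C_0, isCoprime_X_sub_C_iff]
    simpa [serrePoly] using hp 0 hx.ne_zero
  · rw [← C_1, isCoprime_X_sub_C_iff]
    have := hp 1 hx.ne_one
    simp only [serrePoly, eval_sub, eval_neg, eval_mul, eval_C, eval_X, eval_one, sub_self]
    norm_num [this]
  · rw [isCoprime_X_sub_C_iff]
    simp [serrePoly, eval_rootPoly_self, hx.ne_zero i, sub_eq_zero, hx.ne_one i,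
      eval_derivative_rootPoly_ne_zero hx.injective i]

/-- Differentiating the Bézout relation `A D + S R = 1`, with `D = X (X - 1) p` and `R` the Serre
polynomial, shows that `p` divides `A - S'`, because `p` divides `R'`. -/
lemma exists_bezout_serrePoly (hx : IsSolution 8 9 12 x) :
    ∃ S M : ℝ[X], S * serrePoly x + X * (X - 1) * rootPoly x * derivative S +
      X * (X - 1) * rootPoly x ^ 2 * M = 1 := by
  obtain ⟨A, S, hAS⟩ := isCoprime_serrePoly hx
  have hp : IsCoprime (rootPoly x) (X * (X - 1) * derivative (rootPoly x)) := by
    have hR : serrePoly x = -(X * (X - 1) * derivative (rootPoly x)) +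
        -(C (5 / 6) * X - C (1 / 3)) * rootPoly x := by
      rw [serrePoly]
      ring
    have h := (isCoprime_serrePoly hx).of_mul_left_right
    rw [hR, IsCoprime.add_mul_right_right_iff, IsCoprime.neg_right_iff] at h
    exact h
  obtain ⟨M, hM⟩ : rootPoly x ∣ A - derivative S := by
    refine hp.dvd_of_dvd_mul_left ?_
    have hderiv := congrArg derivative hAS
    simp only [derivative_add, derivative_mul, derivative_serrePoly hx, derivative_sub,
      derivative_X, derivative_one] at hderiv
    refine ⟨derivative S * (C (5 / 6) * X - C (1 / 3)) -
      derivative A * (X * (X - 1)) - A * (2 * X - 1) -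
        S * C (1 / 144 - ((12 * (n : ℝ) + 11) / 12) ^ 2), ?_⟩
    rw [serrePoly] at hderiv
    linear_combination hderiv
  exact ⟨S, M, by linear_combination hAS - X * (X - 1) * rootPoly x * hM⟩

end Stieltjes

section InverseSquare

variable {u h F : ℂ → ℂ} {a z : ℂ}

lemma hasResidueAt_zero_of_primitive (hd : ∀ᶠ z in 𝓝[≠] a, HasDerivAt h (F z) z)
    (hc : ∀ᶠ z in 𝓝[≠] a, ContinuousAt F z) : HasResidueAt F a 0 := by
  obtain ⟨ε, hε, hball⟩ := Metric.mem_nhdsWithin_iff.mp (hd.and hc)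
  filter_upwards [Ioo_mem_nhdsGT hε] with r hr
  have hmem : ∀ z ∈ Metric.sphere a r, HasDerivAt h (F z) z ∧ ContinuousAt F z := fun z hz ↦
    hball ⟨Metric.sphere_subset_ball hr.2 hz, Metric.ne_of_mem_sphere hz hr.1.ne'⟩
  refine ⟨ContinuousOn.circleIntegrable hr.1.le fun z hz ↦ (hmem z hz).2.continuousWithinAt, ?_⟩
  rw [circleIntegral.integral_eq_zero_of_hasDerivWithinAt hr.1.le
    fun z hz ↦ (hmem z hz).1.hasDerivWithinAt, mul_zero]

lemma meromorphicOrderAt_inv_sq (hu : AnalyticAt ℂ u a) (h0 : u a = 0) (h1 : deriv u a ≠ 0) :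
    meromorphicOrderAt (fun z ↦ (u z ^ 2)⁻¹) a = ((-2 : ℤ) : WithTop ℤ) := by
  have horder := hu.analyticOrderAt_deriv_add_one
  rw [hu.deriv.analyticOrderAt_eq_zero.mpr h1] at horder
  simp only [h0, sub_zero, zero_add] at horder
  have hsimple : meromorphicOrderAt u a = ((1 : ℤ) : WithTop ℤ) := by
    rw [hu.meromorphicOrderAt_eq, ← horder]
    rfl
  have hinv : meromorphicOrderAt (u ^ 2)⁻¹ a = ((-2 : ℤ) : WithTop ℤ) := by
    rw [meromorphicOrderAt_inv, meromorphicOrderAt_pow hu.meromorphicAt, hsimple]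
    rfl
  exact hinv

lemma analyticAt_inv_sq (hu : AnalyticAt ℂ u a) (h0 : u a ≠ 0) :
    AnalyticAt ℂ (fun z ↦ (u z ^ 2)⁻¹) a :=
  (hu.fun_pow 2).fun_inv (pow_ne_zero 2 h0)

lemma eventually_ne_zero_of_deriv_ne_zero (hu : AnalyticAt ℂ u a) (h1 : deriv u a ≠ 0) :
    ∀ᶠ z in 𝓝[≠] a, u z ≠ 0 := by
  refine hu.eventually_eq_zero_or_eventually_ne_zero.resolve_left fun h ↦ h1 ?_
  exact (EventuallyEq.deriv_eq h).trans (deriv_const a 0)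

lemma hasDoublePoleZeroResidueAt_inv_sq (hu : AnalyticAt ℂ u a) (h0 : u a = 0)
    (h1 : deriv u a ≠ 0) (hh : ∀ᶠ z in 𝓝[≠] a, HasDerivAt h ((u z ^ 2)⁻¹) z) :
    HasDoublePoleZeroResidueAt (fun z ↦ (u z ^ 2)⁻¹) a := by
  refine ⟨(hu.meromorphicAt.fun_pow 2).fun_inv, meromorphicOrderAt_inv_sq hu h0 h1,
    hasResidueAt_zero_of_primitive hh ?_⟩
  filter_upwards [eventually_ne_zero_of_deriv_ne_zero hu h1,
    hu.eventually_analyticAt.filter_mono nhdsWithin_le_nhds] with z hz hzu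
  exact (analyticAt_inv_sq hzu hz).continuousAt

lemma schwarzian_of_hasDerivAt_inv_sq (hu : AnalyticAt ℂ u z) (h0 : u z ≠ 0)
    (hh : ∀ᶠ w in 𝓝 z, HasDerivAt h ((u w ^ 2)⁻¹) w) :
    schwarzian h z = -2 * (deriv (deriv u) z / u z) := by
  have hne := hu.continuousAt.eventually_ne h0
  have hderiv : ∀ᶠ w in 𝓝 z, deriv h w = (u w ^ 2)⁻¹ := hh.mono fun _ hw ↦ hw.deriv
  have hlogDeriv : (fun w ↦ deriv (deriv h) w / deriv h w) =ᶠ[𝓝 z]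
      fun w ↦ -2 * (deriv u w / u w) := by
    filter_upwards [hderiv.eventually_nhds, hne, hu.eventually_analyticAt] with w hw hw0 hwu
    have hsq := (hwu.differentiableAt.hasDerivAt.fun_pow 2).fun_inv (pow_ne_zero 2 hw0)
    rw [EventuallyEq.deriv_eq hw, hsq.deriv, Eventually.self_of_nhds hw]
    field_simp
    norm_num
    ring
  have hquot := (hu.deriv.differentiableAt.hasDerivAt.fun_div
    hu.differentiableAt.hasDerivAt h0).const_mul (-2)
  rw [schwarzian, hlogDeriv.deriv_eq, hquot.deriv,
    show deriv (deriv h) z / deriv h z = _ from hlogDeriv.self_of_nhds]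
  field_simp
  ring

end InverseSquare

section StieltjesForm

variable {F G : ℍ → ℂ} {τ : ℍ}

lemma hasDerivAt_comp_ofComplex (hF : MDiff F) (k : ℂ) (τ : ℍ) :
    HasDerivAt (F ∘ ofComplex)
      (2 * Real.pi * Complex.I * (serreDerivative k F τ + k / 12 * E2 τ * F τ)) (τ : ℂ) := by
  refine (mdifferentiableAt_iff.mp (hF τ)).hasDerivAt.congr_deriv ?_
  rw [serreDerivative_apply, normalizedDerivOfComplex]
  field_simp
  ring

lemma hasDerivAt_E2 (τ : ℍ) : HasDerivAt (E2 ∘ ofComplex)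
    (2 * Real.pi * Complex.I * ((E2 τ ^ 2 - E₄ τ) / 12)) (τ : ℂ) := by
  refine (hasDerivAt_comp_ofComplex E2_mdifferentiable 1 τ).congr_deriv ?_
  simp only [serreDerivative_one_E2, Pi.smul_apply, smul_eq_mul]
  ring

lemma hasDerivAt_E₄ (τ : ℍ) : HasDerivAt (E₄ ∘ ofComplex)
    (2 * Real.pi * Complex.I * ((E2 τ * E₄ τ - E₆ τ) / 3)) (τ : ℂ) := by
  refine (hasDerivAt_comp_ofComplex E₄.holo' 4 τ).congr_deriv ?_
  change _ * (serreDerivative 4 E₄ τ + _ * _ * E₄ τ) = _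
  simp only [serreDerivative_E₄, Pi.smul_apply, smul_eq_mul]
  ring

lemma hasDerivAt_E₆ (τ : ℍ) : HasDerivAt (E₆ ∘ ofComplex)
    (2 * Real.pi * Complex.I * ((E2 τ * E₆ τ - E₄ τ ^ 2) / 2)) (τ : ℂ) := by
  refine (hasDerivAt_comp_ofComplex E₆.holo' 6 τ).congr_deriv ?_
  change _ * (serreDerivative 6 E₆ τ + _ * _ * E₆ τ) = _
  simp only [serreDerivative_E₆, Pi.smul_apply, Pi.mul_apply, smul_eq_mul]
  ring

/-- The Dedekind eta function as a function on the upper half-plane. -/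
def etaH (τ : ℍ) : ℂ := eta τ

lemma etaH_ne_zero (τ : ℍ) : etaH τ ≠ 0 := eta_ne_zero τ.2

lemma hasDerivAt_etaH (τ : ℍ) : HasDerivAt (etaH ∘ ofComplex)
    (2 * Real.pi * Complex.I * (E2 τ * etaH τ / 24)) (τ : ℂ) := by
  have hlog := logDeriv_eta_eq_E2 τ
  rw [logDeriv_apply, div_eq_iff (eta_ne_zero τ.2)] at hlog
  have hcongr : etaH ∘ ofComplex =ᶠ[𝓝 (τ : ℂ)] eta := by
    filter_upwards [isOpen_upperHalfPlaneSet.mem_nhds τ.im_pos] with z hz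
    simp [etaH, ofComplex_apply_of_im_pos hz]
  refine ((differentiableAt_eta_of_mem_upperHalfPlaneSet τ.2).hasDerivAt.congr_of_eventuallyEq
    hcongr).congr_deriv ?_
  rw [hlog, etaH]
  ring

lemma E₄_cube_eq (τ : ℍ) : E₄ τ ^ 3 = 1728 * etaH τ ^ 24 * kleinJ τ := by
  have := etaH_ne_zero τ
  rw [kleinJ, discriminant, ← etaH]
  field_simp

lemma E₆_sq_eq (τ : ℍ) : E₆ τ ^ 2 = 1728 * etaH τ ^ 24 * (kleinJ τ - 1) := by
  have hΔ := discriminant_eq_E₄_cube_sub_E₆_sq τ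
  rw [discriminant, ← etaH] at hΔ
  linear_combination E₄_cube_eq τ + 1728 * hΔ

lemma hasDerivAt_aeval_kleinJ (p : Polynomial ℝ) (τ : ℍ) :
    HasDerivAt (fun z ↦ p.aeval (kleinJ (ofComplex z)))
      (2 * Real.pi * Complex.I *
        (-(E₄ τ ^ 2 * E₆ τ / (1728 * etaH τ ^ 24)) * p.derivative.aeval (kleinJ τ))) (τ : ℂ) := by
  have h0 : etaH τ ≠ 0 := etaH_ne_zero τ
  have hJ : HasDerivAt (fun z ↦ (E₄ ∘ ofComplex) z ^ 3 / (1728 * (etaH ∘ ofComplex) z ^ 24)) _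
      (τ : ℂ) := ((hasDerivAt_E₄ τ).fun_pow 3).fun_div
        (((hasDerivAt_etaH τ).fun_pow 24).const_mul 1728) (by simp [h0])
  have hp := p.hasDerivAt_aeval (kleinJ (ofComplex τ))
  refine (hp.comp (τ : ℂ) hJ).congr_deriv ?_
  simp only [comp_apply, ofComplex_apply]
  field_simp
  ring

/-- The weight `-1` form `E₄ E₆ ∏ (J - xᵢ) / η²²`, whose inverse square is `fForm x`. -/
def stieltjesForm {n : ℕ} (x : Fin n → ℝ) (τ : ℍ) : ℂ :=
  E₄ τ * E₆ τ * (rootPoly x).aeval (kleinJ τ) / etaH τ ^ 22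

/-- The Serre derivative of `stieltjesForm x`. -/
def serreStieltjesForm {n : ℕ} (x : Fin n → ℝ) (τ : ℍ) : ℂ :=
  1728 * etaH τ ^ 2 * (serrePoly x).aeval (kleinJ τ)

variable {n : ℕ} {x : Fin n → ℝ}

lemma fForm_eq (x : Fin n → ℝ) (τ : ℍ) : fForm x τ = (stieltjesForm x τ ^ 2)⁻¹ := by
  rw [fForm, stieltjesForm, aeval_rootPoly, Finset.prod_pow, ← etaH, div_pow, inv_div]
  congr 1 <;> ring

lemma fForm_comp_ofComplex (x : Fin n → ℝ) :
    fForm x ∘ ofComplex = fun z ↦ ((stieltjesForm x ∘ ofComplex) z ^ 2)⁻¹ :=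
  funext fun z ↦ fForm_eq x (ofComplex z)

lemma hasDerivAt_stieltjesForm (x : Fin n → ℝ) (τ : ℍ) :
    HasDerivAt (stieltjesForm x ∘ ofComplex)
      (2 * Real.pi * Complex.I * (serreStieltjesForm x τ - E2 τ / 12 * stieltjesForm x τ))
      (τ : ℂ) := by
  have h0 : etaH τ ≠ 0 := etaH_ne_zero τ
  have h := (((hasDerivAt_E₄ τ).fun_mul (hasDerivAt_E₆ τ)).fun_mul
    (hasDerivAt_aeval_kleinJ (rootPoly x) τ)).fun_div ((hasDerivAt_etaH τ).fun_pow 22)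
    (by simp [h0])
  refine h.congr_deriv ?_
  simp only [comp_apply, ofComplex_apply, stieltjesForm, serreStieltjesForm, serrePoly, map_sub,
    map_mul, map_neg, Polynomial.aeval_C, Polynomial.aeval_X, map_one,
    Complex.coe_algebraMap]
  have h4 := E₄_cube_eq τ
  have h6 := E₆_sq_eq τ
  generalize (rootPoly x).aeval (kleinJ τ) = p
  generalize (Polynomial.derivative (rootPoly x)).aeval (kleinJ τ) = p'
  generalize kleinJ τ = J at *
  generalize E₄ τ = a at *
  generalize E₆ τ = b at *
  generalize etaH τ = t at *
  push_cast
  field_simp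
  linear_combination (-(2 * p * 1728 * t ^ 24 * 1728) - 6 * 1728 * p' * (1728 * t ^ 24 * J)) * h6 +
    (-(3 * p * 1728 * t ^ 24 * 1728) - 6 * 1728 * p' * b ^ 2) * h4

lemma hasDerivAt_serreStieltjesForm (hx : IsSolution 8 9 12 x) (τ : ℍ) :
    HasDerivAt (serreStieltjesForm x ∘ ofComplex)
      (2 * Real.pi * Complex.I * ((((12 * n + 11) / 12) ^ 2 - 1 / 144) * E₄ τ * stieltjesForm x τ +
        E2 τ / 12 * serreStieltjesForm x τ)) (τ : ℂ) := by
  have h0 : etaH τ ≠ 0 := etaH_ne_zero τ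
  refine ((((hasDerivAt_etaH τ).fun_pow 2).const_mul 1728).fun_mul
    (hasDerivAt_aeval_kleinJ (serrePoly x) τ)).congr_deriv ?_
  simp only [derivative_serrePoly hx, comp_apply, ofComplex_apply, stieltjesForm,
    serreStieltjesForm, map_mul, Polynomial.aeval_C]
  field_simp
  push_cast
  ring

lemma deriv_deriv_of_ramanujan {κ : ℂ}
    (hF : ∀ τ : ℍ, HasDerivAt (F ∘ ofComplex)
      (2 * Real.pi * Complex.I * (G τ - E2 τ / 12 * F τ)) (τ : ℂ))
    (hG : ∀ τ : ℍ, HasDerivAt (G ∘ ofComplex)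
      (2 * Real.pi * Complex.I * (κ * E₄ τ * F τ + E2 τ / 12 * G τ)) (τ : ℂ)) (τ : ℍ) :
    deriv (deriv (F ∘ ofComplex)) τ = -4 * Real.pi ^ 2 * (κ + 1 / 144) * E₄ τ * F τ := by
  have hderiv : deriv (F ∘ ofComplex) =ᶠ[𝓝 (τ : ℂ)] fun z ↦ 2 * Real.pi * Complex.I *
      ((G ∘ ofComplex) z - (E2 ∘ ofComplex) z / 12 * (F ∘ ofComplex) z) := by
    filter_upwards [isOpen_upperHalfPlaneSet.mem_nhds τ.im_pos] with z hz
    simpa [ofComplex_apply_of_im_pos hz] using (hF ⟨z, hz⟩).deriv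
  rw [hderiv.deriv_eq, (((hG τ).fun_sub (((hasDerivAt_E2 τ).div_const 12).fun_mul
    (hF τ))).const_mul (2 * Real.pi * Complex.I)).deriv]
  simp only [comp_apply, ofComplex_apply]
  linear_combination (4 * Real.pi ^ 2 * (κ + 1 / 144) * E₄ τ * F τ) * Complex.I_sq

end StieltjesForm

section Lattice

/-- A nonzero solution of order `m` at the origin would force `m * A 0 = B 0`. -/
lemma eventually_eq_zero_of_regular_singular {f A B : ℂ → ℂ} (hf : AnalyticAt ℂ f 0)
    (hA : ContinuousAt A 0) (hB : ContinuousAt B 0) (hAB : ∀ m : ℕ, m * A 0 ≠ B 0)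
    (h : ∀ᶠ w in 𝓝[≠] (0 : ℂ), w * deriv f w * A w = B w * f w) : ∀ᶠ w in 𝓝 (0 : ℂ), f w = 0 := by
  by_contra hne
  obtain ⟨m, g, hg, hg0, hfg⟩ := hf.exists_eventuallyEq_pow_smul_nonzero_iff.mpr hne
  simp only [sub_zero, smul_eq_mul] at hfg
  have hderiv : ∀ᶠ w in 𝓝 (0 : ℂ), w * deriv f w = w ^ m * (m * g w + w * deriv g w) := by
    filter_upwards [hfg.eventually_nhds, hg.eventually_analyticAt] with w hw hgw
    rw [EventuallyEq.deriv_eq hw,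
      ((hasDerivAt_pow m w).fun_mul hgw.differentiableAt.hasDerivAt).deriv]
    rcases m with _ | m
    · simp
    · rw [Nat.add_sub_cancel]
      ring
  have hzero : ∀ᶠ w in 𝓝[≠] (0 : ℂ), (m * g w + w * deriv g w) * A w - B w * g w = 0 := by
    filter_upwards [h, hfg.filter_mono nhdsWithin_le_nhds, hderiv.filter_mono nhdsWithin_le_nhds,
      self_mem_nhdsWithin] with w hode hfw hdw hw
    rw [hdw, hfw] at hode
    apply mul_left_cancel₀ (pow_ne_zero m hw)
    linear_combination hode
  have hcont : ContinuousAt (fun w ↦ (m * g w + w * deriv g w) * A w - B w * g w) 0 := by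
    have hgc := hg.continuousAt
    have hg'c := hg.deriv.continuousAt
    fun_prop
  have hlim := tendsto_nhds_unique (hcont.tendsto.mono_left nhdsWithin_le_nhds)
    (tendsto_const_nhds.congr' (hzero.mono fun w hw ↦ hw.symm))
  refine hAB m (mul_right_cancel₀ hg0 ?_)
  linear_combination hlim

lemma weierstrassPExcept_cubic (L : PeriodPair) {w : ℂ} (hw : w ≠ 0)
    (hL : w ∈ ((L.lattice : Set ℂ) \ {0})ᶜ) :
    (w ^ 3 * L.derivWeierstrassPExcept 0 w - 2) ^ 2 =
      4 * (w ^ 2 * L.weierstrassPExcept 0 w + 1) ^ 3 -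
        L.g₂ * w ^ 4 * (w ^ 2 * L.weierstrassPExcept 0 w + 1) - L.g₃ * w ^ 6 := by
  have hP := L.weierstrassPExcept_def 0 w
  have hP' := L.derivWeierstrassPExcept_def 0 w
  simp only [ZeroMemClass.coe_zero, sub_zero, ne_eq, OfNat.ofNat_ne_zero, not_false_eq_true,
    zero_pow, div_zero] at hP hP'
  have hcubic := L.derivWeierstrassP_sq w fun hm ↦ hL ⟨hm, hw⟩
  rw [hP, hP']
  field_simp
  ring_nf
  linear_combination w ^ 6 * hcubic

lemma derivWeierstrassPExcept_sub_ode {L₁ L₂ : PeriodPair} (h₂ : L₁.g₂ = L₂.g₂)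
    (h₃ : L₁.g₃ = L₂.g₃) {w : ℂ} (hw : w ≠ 0) (hw₁ : w ∈ ((L₁.lattice : Set ℂ) \ {0})ᶜ)
    (hw₂ : w ∈ ((L₂.lattice : Set ℂ) \ {0})ᶜ) :
    w * (L₁.derivWeierstrassPExcept 0 w - L₂.derivWeierstrassPExcept 0 w) *
        ((w ^ 3 * L₁.derivWeierstrassPExcept 0 w - 2) +
          (w ^ 3 * L₂.derivWeierstrassPExcept 0 w - 2)) =
      (4 * ((w ^ 2 * L₁.weierstrassPExcept 0 w + 1) ^ 2 +
        (w ^ 2 * L₁.weierstrassPExcept 0 w + 1) * (w ^ 2 * L₂.weierstrassPExcept 0 w + 1) +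
          (w ^ 2 * L₂.weierstrassPExcept 0 w + 1) ^ 2) - L₁.g₂ * w ^ 4) *
        (L₁.weierstrassPExcept 0 w - L₂.weierstrassPExcept 0 w) := by
  have hcubic₁ := weierstrassPExcept_cubic L₁ hw hw₁
  have hcubic₂ := weierstrassPExcept_cubic L₂ hw hw₂
  rw [← h₂, ← h₃] at hcubic₂
  apply mul_left_cancel₀ (pow_ne_zero 2 hw)
  linear_combination hcubic₁ - hcubic₂

/-- The difference of two solutions of the same cubic equation is holomorphic at the origin and
satisfies a regular singular equation with exponent `-3` there, hence vanishes. -/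
lemma weierstrassP_eventuallyEq {L₁ L₂ : PeriodPair} (h₂ : L₁.g₂ = L₂.g₂) (h₃ : L₁.g₃ = L₂.g₃) :
    L₁.weierstrassP =ᶠ[𝓝[≠] 0] L₂.weierstrassP := by
  have hP₁ := L₁.analyticAt_weierstrassPExcept 0
  have hP₂ := L₂.analyticAt_weierstrassPExcept 0
  have hP₁c := hP₁.continuousAt
  have hP₂c := hP₂.continuousAt
  have hD₁c := (L₁.analyticAt_derivWeierstrassPExcept 0).continuousAt
  have hD₂c := (L₂.analyticAt_derivWeierstrassPExcept 0).continuousAt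
  have hzero := eventually_eq_zero_of_regular_singular
    (f := fun w ↦ L₁.weierstrassPExcept 0 w - L₂.weierstrassPExcept 0 w)
    (A := fun w ↦ (w ^ 3 * L₁.derivWeierstrassPExcept 0 w - 2) +
      (w ^ 3 * L₂.derivWeierstrassPExcept 0 w - 2))
    (B := fun w ↦ 4 * ((w ^ 2 * L₁.weierstrassPExcept 0 w + 1) ^ 2 +
      (w ^ 2 * L₁.weierstrassPExcept 0 w + 1) * (w ^ 2 * L₂.weierstrassPExcept 0 w + 1) +
      (w ^ 2 * L₂.weierstrassPExcept 0 w + 1) ^ 2) - L₁.g₂ * w ^ 4)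
    (hP₁.fun_sub hP₂) (by fun_prop) (by fun_prop)
    (fun m h ↦ by
      have h12 : ((4 * m + 12 : ℕ) : ℂ) = 0 := by
        push_cast
        linear_combination -h
      norm_cast at h12)
    (by
      filter_upwards [self_mem_nhdsWithin,
        mem_nhdsWithin_of_mem_nhds (L₁.compl_lattice_sdiff_singleton_mem_nhds 0),
        mem_nhdsWithin_of_mem_nhds (L₂.compl_lattice_sdiff_singleton_mem_nhds 0)] with w hw hw₁ hw₂
      rw [deriv_fun_sub (L₁.analyticOnNhd_weierstrassPExcept 0 w hw₁).differentiableAt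
        (L₂.analyticOnNhd_weierstrassPExcept 0 w hw₂).differentiableAt,
        L₁.eqOn_deriv_weierstrassPExcept_derivWeierstrassPExcept 0 hw₁,
        L₂.eqOn_deriv_weierstrassPExcept_derivWeierstrassPExcept 0 hw₂]
      exact derivWeierstrassPExcept_sub_ode h₂ h₃ hw hw₁ hw₂)
  filter_upwards [hzero.filter_mono nhdsWithin_le_nhds] with w hw
  have hdef₁ := L₁.weierstrassPExcept_def 0 w
  have hdef₂ := L₂.weierstrassPExcept_def 0 w
  rw [ZeroMemClass.coe_zero] at hdef₁ hdef₂
  linear_combination hw - hdef₁ + hdef₂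

lemma lattice_le_of_weierstrassP_eventuallyEq {L₁ L₂ : PeriodPair}
    (h : L₁.weierstrassP =ᶠ[𝓝[≠] 0] L₂.weierstrassP) : L₁.lattice ≤ L₂.lattice := by
  intro l hl
  by_contra hl₂
  have hmero : MeromorphicOn (L₁.weierstrassP - L₂.weierstrassP) Set.univ := fun z _ ↦
    (L₁.meromorphic_weierstrassP z).sub (L₂.meromorphic_weierstrassP z)
  have hzero : meromorphicOrderAt (L₁.weierstrassP - L₂.weierstrassP) 0 = ⊤ :=
    meromorphicOrderAt_eq_top_iff.mpr (h.mono fun w hw ↦ sub_eq_zero.mpr hw)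
  have hl_top : meromorphicOrderAt (L₁.weierstrassP - L₂.weierstrassP) l = ⊤ := by
    by_contra hne
    exact hmero.meromorphicOrderAt_ne_top_of_isPreconnected isPreconnected_univ (Set.mem_univ l)
      (Set.mem_univ 0) hne hzero
  have hcongr : L₁.weierstrassP =ᶠ[𝓝[≠] l] L₂.weierstrassP :=
    (meromorphicOrderAt_eq_top_iff.mp hl_top).mono fun w hw ↦ sub_eq_zero.mp hw
  have hpole := L₁.order_weierstrassP l hl
  have hnonneg := (L₂.analyticOnNhd_weierstrassP l hl₂).meromorphicOrderAt_nonneg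
  rw [← meromorphicOrderAt_congr hcongr, hpole] at hnonneg
  exact absurd hnonneg (by decide)

lemma lattice_eq_of_g₂_g₃ {L₁ L₂ : PeriodPair} (h₂ : L₁.g₂ = L₂.g₂) (h₃ : L₁.g₃ = L₂.g₃) :
    L₁.lattice = L₂.lattice :=
  le_antisymm (lattice_le_of_weierstrassP_eventuallyEq (weierstrassP_eventuallyEq h₂ h₃))
    (lattice_le_of_weierstrassP_eventuallyEq (weierstrassP_eventuallyEq h₂.symm h₃.symm))

lemma eq_zero_of_real_mul_add_eq_zero {τ : ℍ} {s t : ℝ} (h : (s : ℂ) * τ + t = 0) :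
    s = 0 ∧ t = 0 := by
  have hs : s = 0 := by simpa [τ.im_ne_zero] using congrArg Complex.im h
  subst hs
  exact ⟨rfl, by simpa using h⟩

/-- The basis `(cτ, c)` of the lattice `c(ℤτ + ℤ)`. -/
def periodPair (c : ℂ) (hc : c ≠ 0) (τ : ℍ) : PeriodPair where
  ω₁ := c * τ
  ω₂ := c
  indep := by
    rw [LinearIndependent.pair_iff]
    intro s t h
    refine eq_zero_of_real_mul_add_eq_zero (τ := τ) (mul_left_cancel₀ hc ?_)
    simp only [Complex.real_smul] at h
    linear_combination h

lemma G_periodPair (c : ℂ) (hc : c ≠ 0) (τ : ℍ) {k : ℕ} (hk : 3 ≤ k) :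
    (periodPair c hc τ).G k = (c ^ k)⁻¹ * (2 * riemannZeta k) * ModularForm.E hk τ := by
  have hsum := tsum_eisSummand_eq_riemannZeta_mul_eisensteinSeries hk τ
  have hE : ModularForm.E hk τ = (1 / 2 : ℂ) * eisensteinSeries (N := 1) 0 k τ := rfl
  have hζ : (c ^ k)⁻¹ * (2 * riemannZeta k) * ((1 / 2 : ℂ) * eisensteinSeries (N := 1) 0 k τ) =
    (c ^ k)⁻¹ * (riemannZeta k * eisensteinSeries (N := 1) 0 k τ) := by ring
  rw [hE, hζ, ← hsum, PeriodPair.G, ← (periodPair c hc τ).latticeEquivProd.symm.toEquiv.tsum_eq,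
    ← tsum_mul_left, ← (finTwoArrowEquiv ℤ).tsum_eq]
  refine tsum_congr fun v ↦ ?_
  have hl : (((periodPair c hc τ).latticeEquivProd.symm (v 0, v 1) : _) : ℂ) =
      v 0 * (c * τ) + v 1 * c := PeriodPair.latticeEquiv_symm_apply _ _
  change ((((periodPair c hc τ).latticeEquivProd.symm (v 0, v 1) : _) : ℂ) ^ k)⁻¹ = _
  rw [hl, eisSummand, zpow_neg, zpow_natCast, ← mul_inv, ← mul_pow]
  congr 2
  ring

/-- Two elliptic curves over `ℂ` with the same `j`-invariant are isomorphic: `t` stands for the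
discriminant. -/
lemma exists_scaling {a b a' b' t t' : ℂ} (ht : t ≠ 0) (ht' : t' ≠ 0)
    (ha : a ^ 3 * t' = a' ^ 3 * t) (hb : b ^ 2 * t' = b' ^ 2 * t) :
    ∃ μ : ℂ, μ ≠ 0 ∧ a' = μ ^ 4 * a ∧ b' = μ ^ 6 * b := by
  obtain ⟨ν, hν⟩ := IsAlgClosed.exists_pow_nat_eq (t' / t) (by norm_num : 0 < 12)
  have hν' : t' = ν ^ 12 * t := by rw [hν, div_mul_cancel₀ _ ht]
  have hν0 : ν ≠ 0 := by
    rintro rfl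
    simp [ht'] at hν'
  rw [hν'] at ha hb
  have ha3 : a' ^ 3 = (ν ^ 4 * a) ^ 3 := mul_right_cancel₀ ht (by linear_combination -ha)
  have hb2 : b' ^ 2 = (ν ^ 6 * b) ^ 2 := mul_right_cancel₀ ht (by linear_combination -hb)
  obtain ⟨ω, hω, haω⟩ : ∃ ω : ℂ, ω ^ 3 = 1 ∧ a' = ω * (ν ^ 4 * a) := by
    by_cases h0 : ν ^ 4 * a = 0
    · refine ⟨1, one_pow 3, ?_⟩
      rw [h0] at ha3 ⊢
      simpa using ha3
    · refine ⟨a' / (ν ^ 4 * a), ?_, (div_mul_cancel₀ _ h0).symm⟩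
      rw [div_pow, ha3, div_self (pow_ne_zero 3 h0)]
  obtain ⟨s, hs4, hbs⟩ : ∃ s : ℂ, s ^ 4 = 1 ∧ b' = s ^ 6 * (ν ^ 6 * b) := by
    rcases sq_eq_sq_iff_eq_or_eq_neg.mp hb2 with h | h
    · exact ⟨1, one_pow 4, by rw [h, one_pow, one_mul]⟩
    · refine ⟨Complex.I, Complex.I_pow_four, ?_⟩
      rw [h, pow_add Complex.I 4 2, Complex.I_pow_four, Complex.I_sq]
      ring
  have hω0 : ω ≠ 0 := by
    rintro rfl
    simp at hω
  have hs0 : s ≠ 0 := by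
    rintro rfl
    simp at hs4
  refine ⟨ν * ω * s, by simp [hν0, hω0, hs0], ?_, ?_⟩
  · rw [haω]
    linear_combination (-(ν ^ 4 * a * ω ^ 4)) * hs4 - (ν ^ 4 * a * ω) * hω
  · rw [hbs]
    linear_combination (-(ν ^ 6 * b * s ^ 6) * (ω ^ 3 + 1)) * hω

lemma exists_smul_eq_of_isUnit_det {τ τ' : ℍ} {p q r s : ℤ} (hdet : IsUnit (p * s - q * r))
    (h : (τ' : ℂ) * (r * τ + s) = p * τ + q) : ∃ γ : SL(2, ℤ), γ • τ = τ' := by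
  have hden : (r * τ + s : ℂ) ≠ 0 := fun h0 ↦ by
    obtain ⟨hr, hs⟩ :=
      eq_zero_of_real_mul_add_eq_zero (s := r) (t := s) (τ := τ) (by simpa using h0)
    rw [Int.cast_eq_zero] at hr hs
    simp [hr, hs] at hdet
  have him : τ'.im * Complex.normSq (r * τ + s) = ((p * s - q * r : ℤ) : ℝ) * τ.im := by
    have hre := congrArg Complex.re h
    have him := congrArg Complex.im h
    simp only [Complex.mul_re, Complex.mul_im, Complex.add_re, Complex.add_im, Complex.intCast_re,
      Complex.intCast_im, coe_re, coe_im, zero_mul, sub_zero, add_zero] at hre him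
    simp only [Complex.normSq_apply, Complex.mul_re, Complex.mul_im, Complex.add_re,
      Complex.add_im, Complex.intCast_re, Complex.intCast_im, coe_re, coe_im, zero_mul, sub_zero,
      add_zero]
    push_cast
    linear_combination (r * τ.re + s) * him - r * τ.im * hre
  have hpos : 0 < p * s - q * r := by
    have hmul := mul_pos τ'.im_pos (Complex.normSq_pos.mpr hden)
    rw [him] at hmul
    exact_mod_cast pos_of_mul_pos_left hmul τ.im_pos.le
  have hdet1 : p * s - q * r = 1 := (Int.isUnit_iff.mp hdet).resolve_right (by omega)
  obtain ⟨γ, hγ⟩ : ∃ γ : SL(2, ℤ), (γ : Matrix (Fin 2) (Fin 2) ℤ) = !![p, q; r, s] :=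
    ⟨⟨!![p, q; r, s], by rw [Matrix.det_fin_two_of, hdet1]⟩, rfl⟩
  refine ⟨γ, ?_⟩
  ext
  rw [coe_specialLinearGroup_apply]
  simpa [hγ] using (div_eq_iff hden).mpr h.symm

lemma exists_smul_eq_of_lattice_eq {c : ℂ} (hc : c ≠ 0) {τ τ' : ℍ}
    (h : (periodPair 1 one_ne_zero τ').lattice = (periodPair c hc τ).lattice) :
    ∃ γ : SL(2, ℤ), γ • τ = τ' := by
  obtain ⟨p, q, hpq⟩ := PeriodPair.mem_lattice.mp (h ▸ PeriodPair.ω₁_mem_lattice _)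
  obtain ⟨r, s, hrs⟩ := PeriodPair.mem_lattice.mp (h ▸ PeriodPair.ω₂_mem_lattice _)
  obtain ⟨p', q', hpq'⟩ := PeriodPair.mem_lattice.mp (h.symm ▸ PeriodPair.ω₁_mem_lattice _)
  obtain ⟨r', s', hrs'⟩ := PeriodPair.mem_lattice.mp (h.symm ▸ PeriodPair.ω₂_mem_lattice _)
  simp only [periodPair, one_mul, mul_one] at hpq hrs hpq' hrs'
  obtain ⟨h₁₁, h₁₂⟩ := eq_zero_of_real_mul_add_eq_zero (τ := τ')
    (s := p * p' + q * r' - 1) (t := p * q' + q * s') (by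
      push_cast
      linear_combination hpq + p * hpq' + q * hrs')
  obtain ⟨-, h₂₂⟩ := eq_zero_of_real_mul_add_eq_zero (τ := τ')
    (s := r * p' + s * r') (t := r * q' + s * s' - 1) (by
      push_cast
      linear_combination hrs + r * hpq' + s * hrs')
  have hdet : (p * s - q * r) * (p' * s' - q' * r') = 1 := by
    have hreal : ((p : ℝ) * s - q * r) * (p' * s' - q' * r') = 1 := by
      linear_combination (r * q' + s * s') * h₁₁ + h₂₂ - (r * p' + s * r') * h₁₂
    exact_mod_cast hreal
  refine exists_smul_eq_of_isUnit_det (IsUnit.of_mul_eq_one _ hdet) (mul_left_cancel₀ hc ?_)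
  linear_combination (τ' : ℂ) * hrs - hpq

/-- `E₄` and `E₆` are, up to constants, the invariants `g₂` and `g₃` of the lattice `ℤτ + ℤ`. -/
lemma exists_smul_eq_of_kleinJ_eq {τ τ' : ℍ} (h : kleinJ τ = kleinJ τ') :
    ∃ γ : SL(2, ℤ), γ • τ = τ' := by
  obtain ⟨μ, hμ, h4, h6⟩ := exists_scaling (a := E₄ τ) (b := E₆ τ) (a' := E₄ τ') (b' := E₆ τ')
    (t := etaH τ ^ 24) (t' := etaH τ' ^ 24) (pow_ne_zero _ (etaH_ne_zero τ))
    (pow_ne_zero _ (etaH_ne_zero τ'))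
    (by rw [E₄_cube_eq, E₄_cube_eq, h]; ring) (by rw [E₆_sq_eq, E₆_sq_eq, h]; ring)
  refine exists_smul_eq_of_lattice_eq (inv_ne_zero hμ) (lattice_eq_of_g₂_g₃ ?_ ?_)
  · rw [PeriodPair.g₂, PeriodPair.g₂, G_periodPair _ _ _ (by norm_num),
      G_periodPair _ _ _ (by norm_num), h4, one_pow, inv_pow, inv_inv]
    ring
  · rw [PeriodPair.g₃, PeriodPair.g₃, G_periodPair _ _ _ (by norm_num),
      G_periodPair _ _ _ (by norm_num), h6, one_pow, inv_pow, inv_inv]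
    ring

end Lattice

section Integral

open Polynomial

lemma differentiableOn_of_forall_hasDerivAt {f : ℂ → ℂ} {f' : ℍ → ℂ}
    (h : ∀ τ : ℍ, HasDerivAt f (f' τ) (τ : ℂ)) : DifferentiableOn ℂ f upperHalfPlaneSet :=
  fun z hz ↦ (h ⟨z, hz⟩).differentiableAt.differentiableWithinAt

lemma analyticAt_of_forall_hasDerivAt {f : ℂ → ℂ} {f' : ℍ → ℂ}
    (h : ∀ τ : ℍ, HasDerivAt f (f' τ) (τ : ℂ)) (τ : ℍ) : AnalyticAt ℂ f (τ : ℂ) :=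
  (differentiableOn_of_forall_hasDerivAt h).analyticAt
    (isOpen_upperHalfPlaneSet.mem_nhds τ.im_pos)

lemma exists_primitive_of_differentiableOn {f : ℂ → ℂ}
    (hf : DifferentiableOn ℂ f upperHalfPlaneSet) :
    ∃ P : ℂ → ℂ, ∀ z ∈ upperHalfPlaneSet, HasDerivAt P (f z) z := by
  obtain ⟨P, hP⟩ := (convex_halfSpace_im_gt 0).exists_forall_hasDerivWithinAt hf
  exact ⟨P, fun z hz ↦ (hP z hz).hasDerivAt (isOpen_upperHalfPlaneSet.mem_nhds hz)⟩

variable {n : ℕ} {x : Fin n → ℝ}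

lemma analyticAt_stieltjesForm (x : Fin n → ℝ) (τ : ℍ) :
    AnalyticAt ℂ (stieltjesForm x ∘ ofComplex) (τ : ℂ) :=
  analyticAt_of_forall_hasDerivAt (hasDerivAt_stieltjesForm x) τ

lemma E₄_eq_zero_iff (τ : ℍ) : E₄ τ = 0 ↔ kleinJ τ = 0 := by
  rw [← pow_eq_zero_iff three_ne_zero, E₄_cube_eq]
  simp [etaH_ne_zero]

lemma E₆_eq_zero_iff (τ : ℍ) : E₆ τ = 0 ↔ kleinJ τ = 1 := by
  rw [← pow_eq_zero_iff two_ne_zero, E₆_sq_eq]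
  simp [etaH_ne_zero, sub_eq_zero]

lemma stieltjesForm_eq_zero_iff (x : Fin n → ℝ) (τ : ℍ) :
    stieltjesForm x τ = 0 ↔ aeval (kleinJ τ) (X * (X - 1) * rootPoly x) = 0 := by
  rw [stieltjesForm, div_eq_zero_iff, or_iff_left (pow_ne_zero 22 (etaH_ne_zero τ))]
  simp only [mul_eq_zero, E₄_eq_zero_iff, E₆_eq_zero_iff, map_mul, map_sub, map_one, aeval_X,
    sub_eq_zero]

lemma deriv_stieltjesForm_ne_zero (hx : IsSolution 8 9 12 x) {τ : ℍ}
    (hτ : stieltjesForm x τ = 0) : deriv (stieltjesForm x ∘ ofComplex) τ ≠ 0 := by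
  obtain ⟨A, S, hAS⟩ := isCoprime_serrePoly hx
  have hserre : aeval (kleinJ τ) (serrePoly x) ≠ 0 := fun h ↦ by
    simpa [(stieltjesForm_eq_zero_iff x τ).mp hτ, h] using congrArg (aeval (kleinJ τ)) hAS
  rw [(hasDerivAt_stieltjesForm x τ).deriv, hτ, mul_zero, sub_zero, serreStieltjesForm]
  simp [hserre, etaH_ne_zero]

lemma eventually_stieltjesForm_ne_zero (hx : IsSolution 8 9 12 x) (τ : ℍ) :
    ∀ᶠ z in 𝓝[≠] (τ : ℂ), (stieltjesForm x ∘ ofComplex) z ≠ 0 := by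
  have hu := analyticAt_stieltjesForm x τ
  by_cases hτ : stieltjesForm x τ = 0
  · exact eventually_ne_zero_of_deriv_ne_zero hu (deriv_stieltjesForm_ne_zero hx hτ)
  · exact (hu.continuousAt.eventually_ne (by simpa)).filter_mono nhdsWithin_le_nhds

lemma hasDerivAt_aeval_div_stieltjesForm {S M : ℝ[X]}
    (hSM : S * serrePoly x + X * (X - 1) * rootPoly x * derivative S +
      X * (X - 1) * rootPoly x ^ 2 * M = 1) {τ : ℍ} (hτ : stieltjesForm x τ ≠ 0) :
    HasDerivAt (fun z ↦ S.aeval (kleinJ (ofComplex z)) /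
        (etaH (ofComplex z) ^ 2 * stieltjesForm x (ofComplex z)))
      (-(1728 * (2 * Real.pi * Complex.I)) * ((stieltjesForm x τ ^ 2)⁻¹ -
        M.aeval (kleinJ τ) * E₄ τ / (1728 ^ 2 * etaH τ ^ 4))) (τ : ℂ) := by
  have hη : etaH τ ≠ 0 := etaH_ne_zero τ
  refine ((hasDerivAt_aeval_kleinJ S τ).fun_div (((hasDerivAt_etaH τ).fun_pow 2).fun_mul
    (hasDerivAt_stieltjesForm x τ)) (by simp [hη, hτ])).congr_deriv ?_
  simp only [comp_apply, ofComplex_apply, serreStieltjesForm]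
  have hbezout := congrArg (aeval (kleinJ τ)) hSM
  simp only [map_add, map_mul, map_sub, map_pow, map_one, aeval_X] at hbezout
  have hS : E₄ τ ^ 2 * E₆ τ * stieltjesForm x τ = 1728 ^ 2 * etaH τ ^ 26 *
      (kleinJ τ * (kleinJ τ - 1) * (rootPoly x).aeval (kleinJ τ)) := by
    rw [stieltjesForm]
    field_simp
    linear_combination (rootPoly x).aeval (kleinJ τ) * (E₆ τ ^ 2 * E₄_cube_eq τ +
      1728 * etaH τ ^ 24 * kleinJ τ * E₆_sq_eq τ)
  have hM : E₄ τ * stieltjesForm x τ ^ 2 = 1728 ^ 2 * etaH τ ^ 4 *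
      (kleinJ τ * (kleinJ τ - 1) * (rootPoly x).aeval (kleinJ τ) ^ 2) := by
    rw [stieltjesForm]
    field_simp
    linear_combination (rootPoly x).aeval (kleinJ τ) ^ 2 * (E₆ τ ^ 2 * E₄_cube_eq τ +
      1728 * etaH τ ^ 24 * kleinJ τ * E₆_sq_eq τ)
  field_simp
  linear_combination -288 * etaH τ ^ 22 * M.aeval (kleinJ τ) * hM -
    288 * (derivative S).aeval (kleinJ τ) * hS - 288 * 1728 ^ 2 * etaH τ ^ 26 * hbezout

lemma exists_hasDerivAt_inv_sq_stieltjesForm (hx : IsSolution 8 9 12 x) :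
    ∃ h : ℂ → ℂ, MeromorphicOn h upperHalfPlaneSet ∧ ∀ τ : ℍ, stieltjesForm x τ ≠ 0 →
      HasDerivAt h ((stieltjesForm x τ ^ 2)⁻¹) (τ : ℂ) := by
  obtain ⟨S, M, hSM⟩ := exists_bezout_serrePoly hx
  have hE : DifferentiableOn ℂ (E₄ ∘ ofComplex) upperHalfPlaneSet :=
    differentiableOn_of_forall_hasDerivAt hasDerivAt_E₄
  have hη : DifferentiableOn ℂ (etaH ∘ ofComplex) upperHalfPlaneSet :=
    differentiableOn_of_forall_hasDerivAt hasDerivAt_etaH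
  obtain ⟨P, hP⟩ := exists_primitive_of_differentiableOn
    (((differentiableOn_of_forall_hasDerivAt (hasDerivAt_aeval_kleinJ M)).fun_mul hE).fun_div
      ((hη.fun_pow 4).const_mul (1728 ^ 2)) fun z _ ↦ by simp [etaH_ne_zero])
  refine ⟨fun z ↦ -(1728 * (2 * Real.pi * Complex.I))⁻¹ * (S.aeval (kleinJ (ofComplex z)) /
    (etaH (ofComplex z) ^ 2 * stieltjesForm x (ofComplex z))) + P z, fun z hz ↦ ?_,
    fun τ hτ ↦ ?_⟩
  · have hPz : AnalyticAt ℂ P z :=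
      analyticAt_of_forall_hasDerivAt (fun τ ↦ hP τ τ.im_pos) ⟨z, hz⟩
    have hSz := analyticAt_of_forall_hasDerivAt (hasDerivAt_aeval_kleinJ S) ⟨z, hz⟩
    have hηz := analyticAt_of_forall_hasDerivAt hasDerivAt_etaH ⟨z, hz⟩
    exact ((MeromorphicAt.const _ z).fun_mul (hSz.meromorphicAt.fun_div ((hηz.fun_pow 2).fun_mul
      (analyticAt_stieltjesForm x ⟨z, hz⟩)).meromorphicAt)).fun_add hPz.meromorphicAt
  · refine (((hasDerivAt_aeval_div_stieltjesForm hSM hτ).const_mul _).fun_add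
      (hP τ τ.im_pos)).congr_deriv ?_
    simp only [comp_apply, ofComplex_apply]
    have := Complex.two_pi_I_ne_zero
    field_simp
    ring

lemma stieltjesForm_ne_zero_of_analyticAt_fForm (hx : IsSolution 8 9 12 x) {τ : ℍ}
    (hτ : AnalyticAt ℂ (fForm x ∘ ofComplex) τ) : stieltjesForm x τ ≠ 0 := fun h0 ↦ by
  have horder := meromorphicOrderAt_inv_sq (analyticAt_stieltjesForm x τ) (by simpa)
    (deriv_stieltjesForm_ne_zero hx h0)
  have := hτ.meromorphicOrderAt_nonneg
  rw [fForm_comp_ofComplex, horder] at this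
  exact absurd this (by decide)

end Integral

section Character

lemma exists_units_forall_eq_mul_of_pow_eq {X : Type*} [TopologicalSpace X] [PreconnectedSpace X]
    {F G : X → ℂ} (hF : Continuous F) (hG : Continuous G) (hG0 : ∀ t, G t ≠ 0) {m : ℕ}
    (hm : 0 < m) (h : ∀ t, F t ^ m = G t ^ m) : ∃ c : ℂˣ, ∀ t, F t = c * G t := by
  have hroot (t : X) : F t / G t ∈ (Polynomial.nthRootsFinset m (1 : ℂ) : Set ℂ) := by
    rw [Finset.mem_coe, Polynomial.mem_nthRootsFinset hm, div_pow, h,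
      div_self (pow_ne_zero m (hG0 t))]
  obtain ⟨c, hc, hconst⟩ := isPreconnected_univ.eqOn_const_of_mapsTo
    (Finset.finite_toSet _).isDiscrete (hF.div₀ hG hG0).continuousOn (fun t _ ↦ hroot t)
    ⟨1, by simp [Polynomial.mem_nthRootsFinset hm]⟩
  have hc0 : c ≠ 0 := by
    rintro rfl
    simp [Polynomial.mem_nthRootsFinset hm, hm.ne'] at hc
  exact ⟨Units.mk0 c hc0, fun t ↦ (div_eq_iff (hG0 t)).mp (hconst (Set.mem_univ t))⟩

lemma denom_mul (γ δ : SL(2, ℤ)) (τ : ℍ) :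
    denom ((γ * δ : SL(2, ℤ)) : GL (Fin 2) ℝ) τ = denom γ (δ • τ : ℍ) * denom δ τ := by
  have h := denom_cocycle_σ (γ : GL (Fin 2) ℝ) (δ : GL (Fin 2) ℝ) τ
  rw [← map_mul, ← map_mul] at h
  simpa [σ] using h

lemma continuous_denom (γ : SL(2, ℤ)) : Continuous fun τ : ℍ ↦ denom (γ : GL (Fin 2) ℝ) τ := by
  simp only [ModularGroup.denom_apply]
  fun_prop

lemma exists_character_of_pow_eq {F : ℍ → ℂ} (hF : Continuous F) (hF0 : ∀ τ, F τ ≠ 0) {m : ℕ}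
    (hm : 0 < m) {k : ℤ} (h : ∀ (γ : SL(2, ℤ)) (τ : ℍ),
      F (γ • τ) ^ m = (denom γ τ ^ k * F τ) ^ m) :
    ∃ χ : SL(2, ℤ) →* ℂˣ, ∀ (γ : SL(2, ℤ)) (τ : ℍ),
      F (γ • τ) = χ γ * (denom γ τ ^ k * F τ) := by
  have hne (γ : SL(2, ℤ)) (τ : ℍ) : denom γ τ ^ k * F τ ≠ 0 :=
    mul_ne_zero (zpow_ne_zero k (denom_ne_zero _ τ)) (hF0 τ)
  have hconst (γ : SL(2, ℤ)) : ∃ c : ℂˣ, ∀ τ : ℍ, F (γ • τ) = c * (denom γ τ ^ k * F τ) :=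
    exists_units_forall_eq_mul_of_pow_eq (hF.comp (continuous_const_smul (γ : GL (Fin 2) ℝ)))
      (((continuous_denom γ).zpow₀ k fun τ ↦ Or.inl (denom_ne_zero _ τ)).mul hF) (hne γ) hm (h γ)
  choose χ hχ using hconst
  refine ⟨MonoidHom.mk' χ fun γ δ ↦ ?_, hχ⟩
  ext
  refine mul_right_cancel₀ (hne (γ * δ) I) ?_
  rw [← hχ, mul_smul, hχ, hχ, denom_mul, mul_zpow, Units.val_mul]
  ring

lemma apply_smul_of_slash_eq {k : ℤ} {F : ℍ → ℂ} {γ : SL(2, ℤ)} (h : F ∣[k] γ = F) (τ : ℍ) :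
    F (γ • τ) = denom γ τ ^ k * F τ := by
  have hτ := congrFun h τ
  rw [SL_slash_apply, zpow_neg] at hτ
  rw [← hτ, mul_comm, mul_assoc, inv_mul_cancel₀ (zpow_ne_zero k (denom_ne_zero _ τ)), mul_one]

lemma E₄_smul (γ : SL(2, ℤ)) (τ : ℍ) : E₄ (γ • τ) = denom γ τ ^ 4 * E₄ τ := by
  exact_mod_cast apply_smul_of_slash_eq (modularForm_slash E₄ γ) τ

lemma E₆_smul (γ : SL(2, ℤ)) (τ : ℍ) : E₆ (γ • τ) = denom γ τ ^ 6 * E₆ τ := by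
  exact_mod_cast apply_smul_of_slash_eq (modularForm_slash E₆ γ) τ

lemma etaH_pow_smul (γ : SL(2, ℤ)) (τ : ℍ) :
    etaH (γ • τ) ^ 24 = denom γ τ ^ 12 * etaH τ ^ 24 := by
  have h := SlashInvariantForm.slash_action_generators_SL2Z discriminant_S_invariant
    discriminant_T_invariant γ
  exact_mod_cast apply_smul_of_slash_eq h τ

lemma kleinJ_smul (γ : SL(2, ℤ)) (τ : ℍ) : kleinJ (γ • τ) = kleinJ τ := by
  have h := E₄_cube_eq (γ • τ)
  rw [E₄_smul, etaH_pow_smul, mul_pow, E₄_cube_eq] at h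
  refine mul_left_cancel₀ (mul_ne_zero (pow_ne_zero 12 (denom_ne_zero (γ : GL (Fin 2) ℝ) τ))
    (pow_ne_zero 24 (etaH_ne_zero τ))) ?_
  linear_combination (-1 / 1728 : ℂ) * h

lemma continuous_etaH : Continuous etaH := by
  refine continuous_iff_continuousAt.mpr fun τ ↦ ?_
  simpa [comp_def] using (hasDerivAt_etaH τ).continuousAt.comp continuous_coe.continuousAt

lemma exists_character_etaH_sq : ∃ χ : SL(2, ℤ) →* ℂˣ, ∀ (γ : SL(2, ℤ)) (τ : ℍ),
    etaH (γ • τ) ^ 2 = χ γ * (denom γ τ * etaH τ ^ 2) := by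
  have hpow (γ : SL(2, ℤ)) (τ : ℍ) :
      (etaH (γ • τ) ^ 2) ^ 12 = (denom γ τ ^ (1 : ℤ) * etaH τ ^ 2) ^ 12 := by
    rw [zpow_one, mul_pow, ← pow_mul, ← pow_mul]
    exact etaH_pow_smul γ τ
  simpa only [zpow_one] using exists_character_of_pow_eq (F := fun τ ↦ etaH τ ^ 2)
    (continuous_etaH.pow 2) (fun τ ↦ pow_ne_zero 2 (etaH_ne_zero τ)) (by norm_num) hpow

variable {n : ℕ}

lemma fForm_smul (x : Fin n → ℝ) {χ : SL(2, ℤ) →* ℂˣ}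
    (hχ : ∀ (γ : SL(2, ℤ)) (τ : ℍ), etaH (γ • τ) ^ 2 = χ γ * (denom γ τ * etaH τ ^ 2))
    (γ : SL(2, ℤ)) (τ : ℍ) :
    fForm x (γ • τ) = χ γ ^ 22 * denom γ τ ^ 2 * fForm x τ := by
  have hd : denom (γ : GL (Fin 2) ℝ) τ ≠ 0 := denom_ne_zero _ τ
  have hη : etaH (γ • τ) ^ 44 = denom γ τ ^ 20 * (χ γ ^ 22 * denom γ τ ^ 2 * etaH τ ^ 44) := by
    rw [show 44 = 2 * 22 from rfl, pow_mul, hχ]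
    ring
  have hE : E₄ (γ • τ) ^ 2 * E₆ (γ • τ) ^ 2 = denom γ τ ^ 20 * (E₄ τ ^ 2 * E₆ τ ^ 2) := by
    rw [E₄_smul, E₆_smul]
    ring
  rw [fForm, fForm, ← etaH, ← etaH, hη, hE]
  simp only [kleinJ_smul]
  rw [mul_assoc (denom γ τ ^ 20), mul_div_mul_left _ _ (pow_ne_zero 20 hd), mul_div_assoc]

end Character

section Cusp

/-- Meromorphy at the cusp, in the parameter `exp (2πiτ / 24)` in which `η` has a simple zero. -/
def IsMeromorphicInQParam (F : ℍ → ℂ) : Prop :=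
  ∃ G : ℂ → ℂ, MeromorphicAt G 0 ∧ ∀ τ : ℍ, F τ = G (Periodic.qParam 24 τ)

lemma isMeromorphicInQParam_of_qParam_one {F : ℍ → ℂ} {G : ℂ → ℂ} (hG : AnalyticAt ℂ G 0)
    (h : ∀ τ : ℍ, F τ = G (Periodic.qParam 1 τ)) : IsMeromorphicInQParam F := by
  have hpow : AnalyticAt ℂ (fun s : ℂ ↦ s ^ 24) 0 := analyticAt_id.fun_pow 24
  refine ⟨fun s ↦ G (s ^ 24), (hG.comp_of_eq hpow (by simp)).meromorphicAt, fun τ ↦ ?_⟩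
  simp only [h, Periodic.qParam, ← Complex.exp_nat_mul]
  congr 2
  push_cast
  ring

lemma isMeromorphicInQParam_modularForm {k : ℤ} (f : ModularForm 𝒮ℒ k) :
    IsMeromorphicInQParam f :=
  isMeromorphicInQParam_of_qParam_one
    (ModularFormClass.analyticAt_cuspFunction_zero f one_pos one_mem_strictPeriods_SL) fun τ ↦ by
      simpa using (SlashInvariantFormClass.eq_cuspFunction (h := 1) f τ
        one_mem_strictPeriods_SL one_ne_zero).symm

lemma isMeromorphicInQParam_etaH : IsMeromorphicInQParam etaH := by
  obtain ⟨G, hG, hGη⟩ := isMeromorphicInQParam_of_qParam_one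
    (F := fun τ ↦ ∏' n : ℕ, (1 - Periodic.qParam 1 (τ : ℂ) ^ (n + 1)))
    (differentiableOn_tprod_one_sub_pow.analyticAt (Metric.ball_mem_nhds 0 one_pos))
    fun _ ↦ rfl
  refine ⟨fun s ↦ s * G s, (MeromorphicAt.id 0).fun_mul hG, fun τ ↦ ?_⟩
  simp only [← hGη]
  rfl

lemma isMeromorphicInQParam_fForm {n : ℕ} (x : Fin n → ℝ) : IsMeromorphicInQParam (fForm x) := by
  obtain ⟨G₄, hG₄, h₄⟩ := isMeromorphicInQParam_modularForm E₄
  obtain ⟨G₆, hG₆, h₆⟩ := isMeromorphicInQParam_modularForm E₆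
  obtain ⟨Gη, hGη, hη⟩ := isMeromorphicInQParam_etaH
  refine ⟨fun s ↦ Gη s ^ 44 / (G₄ s ^ 2 * G₆ s ^ 2 *
    ∏ i, (G₄ s ^ 3 / (1728 * Gη s ^ 24) - (x i : ℂ)) ^ 2), by fun_prop, fun τ ↦ ?_⟩
  simp only [← h₄, ← h₆, ← hη]
  rfl

end Cusp

section Orbits

lemma kleinJ_I : kleinJ I = 1 := by
  rw [← E₆_eq_zero_iff]
  have h := E₆_smul ModularGroup.S I
  have hS : ModularGroup.S • I = I := ModularGroup.stabilizer_I.mpr (by decide)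
  have hI : (I : ℂ) ^ 6 = -1 := by
    rw [coe_I, show Complex.I ^ 6 = (Complex.I ^ 2) ^ 3 by ring, Complex.I_sq]
    norm_num
  rw [hS, ModularGroup.denom_S, hI] at h
  linear_combination h / 2

lemma kleinJ_ρ : kleinJ ρ = 0 := by
  rw [← E₄_eq_zero_iff]
  have h := E₄_smul (ModularGroup.S * ModularGroup.T) ρ
  have hST : (ModularGroup.S * ModularGroup.T) • ρ = ρ :=
    ModularGroup.stabilizer_ρ.mpr (by decide)
  have hdenom : denom ((ModularGroup.S * ModularGroup.T : SL(2, ℤ)) : GL (Fin 2) ℝ) ρ = ρ + 1 := by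
    rw [ModularGroup.denom_apply]
    simp [Matrix.SpecialLinearGroup.coe_mul, ModularGroup.coe_S, ModularGroup.coe_T]
  rw [hST, hdenom] at h
  have hne : (ρ : ℂ) + 2 ≠ 0 := fun h0 ↦ ρ.im_ne_zero (by simpa using congrArg Complex.im h0)
  refine (mul_eq_zero.mp ?_).resolve_left hne
  linear_combination h + E₄ ρ * ((ρ : ℂ) ^ 2 + 3 * ρ + 2) * ρ_sq

lemma mem_orbit_iff_kleinJ_eq {τ τ' : ℍ} :
    τ ∈ MulAction.orbit SL(2, ℤ) τ' ↔ kleinJ τ = kleinJ τ' := by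
  refine ⟨?_, fun h ↦ exists_smul_eq_of_kleinJ_eq h.symm⟩
  rintro ⟨γ, rfl⟩
  exact kleinJ_smul γ τ'

variable {n : ℕ} {x : Fin n → ℝ} {w : Fin n → ℍ}

lemma mem_poleSet_iff (hw : ∀ i, kleinJ (w i) = (x i : ℂ)) (τ : ℍ) :
    τ ∈ poleSet w ↔ stieltjesForm x τ = 0 := by
  simp only [poleSet, Set.mem_union, Set.mem_iUnion, mem_orbit_iff_kleinJ_eq, kleinJ_I, kleinJ_ρ,
    hw, stieltjesForm_eq_zero_iff, map_mul, map_sub, map_one, Polynomial.aeval_X, aeval_rootPoly,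
    mul_eq_zero, Finset.prod_eq_zero_iff, Finset.mem_univ, true_and, sub_eq_zero, or_comm]

end Orbits

section FForm

variable {n : ℕ} {x : Fin n → ℝ}

lemma fForm_eq_eta_pow_div (x : Fin n → ℝ) (τ : ℍ) : fForm x τ =
    eta τ ^ 20 / (1728 * (E₄ τ ^ 2 * (kleinJ τ - 1) * ∏ i, (kleinJ τ - (x i : ℂ)) ^ 2)) := by
  have hη : eta (τ : ℂ) ≠ 0 := etaH_ne_zero τ
  rw [fForm, E₆_sq_eq, etaH, show 44 = 24 + 20 from rfl, pow_add,
    ← mul_div_mul_left (eta τ ^ 20) _ (pow_ne_zero 24 hη)]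
  ring_nf

lemma exists_isMeromorphicModularForm_fForm (x : Fin n → ℝ) :
    ∃ χ : SL(2, ℤ) →* ℂˣ, IsMeromorphicModularForm 2 χ (fForm x) := by
  obtain ⟨χ, hχ⟩ := exists_character_etaH_sq
  obtain ⟨G, hG, hfG⟩ := isMeromorphicInQParam_fForm x
  refine ⟨χ ^ 22, fun τ ↦ ?_, fun γ τ ↦ ?_, 24, by norm_num, G, hG, .of_forall fun τ ↦ ?_⟩
  · rw [fForm_comp_ofComplex]
    exact ((analyticAt_stieltjesForm x τ).meromorphicAt.fun_pow 2).fun_inv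
  · rw [fForm_smul x hχ, ModularGroup.denom_apply]
    norm_cast
  · rw [hfG, Periodic.qParam]
    norm_cast

lemma hasDoublePoleZeroResidueAt_fForm (hx : IsSolution 8 9 12 x) {τ : ℍ}
    (hτ : stieltjesForm x τ = 0) : HasDoublePoleZeroResidueAt (fForm x ∘ ofComplex) τ := by
  obtain ⟨h, -, hh⟩ := exists_hasDerivAt_inv_sq_stieltjesForm hx
  rw [fForm_comp_ofComplex]
  refine hasDoublePoleZeroResidueAt_inv_sq (h := h) (analyticAt_stieltjesForm x τ) (by simpa)
    (deriv_stieltjesForm_ne_zero hx hτ) ?_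
  filter_upwards [eventually_stieltjesForm_ne_zero hx τ,
    mem_nhdsWithin_of_mem_nhds (isOpen_upperHalfPlaneSet.mem_nhds τ.im_pos)] with z hz hzℍ
  simpa [ofComplex_apply_of_im_pos hzℍ] using hh (ofComplex z) hz

lemma analyticAt_fForm {τ : ℍ} (hτ : stieltjesForm x τ ≠ 0) :
    AnalyticAt ℂ (fForm x ∘ ofComplex) τ := by
  rw [fForm_comp_ofComplex]
  exact analyticAt_inv_sq (analyticAt_stieltjesForm x τ) (by simpa)

lemma fForm_ne_zero {τ : ℍ} (hτ : stieltjesForm x τ ≠ 0) : fForm x τ ≠ 0 := by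
  rw [fForm_eq]
  exact inv_ne_zero (pow_ne_zero 2 hτ)

lemma exists_isIntegralOf_fForm (hx : IsSolution 8 9 12 x) :
    ∃ h : ℂ → ℂ, IsIntegralOf h (fForm x ∘ ofComplex) := by
  obtain ⟨h, hmero, hh⟩ := exists_hasDerivAt_inv_sq_stieltjesForm hx
  refine ⟨h, hmero, fun z hz hfz ↦ ?_⟩
  rw [comp_apply, ofComplex_apply_of_im_pos hz, fForm_eq]
  exact hh ⟨z, hz⟩ (stieltjesForm_ne_zero_of_analyticAt_fForm hx hfz)

lemma schwarzian_eq_of_isIntegralOf_fForm (hx : IsSolution 8 9 12 x) {h : ℂ → ℂ}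
    (hh : IsIntegralOf h (fForm x ∘ ofComplex)) {τ : ℍ} (hτ : stieltjesForm x τ ≠ 0) :
    schwarzian h τ = 2 * (Real.pi : ℂ) ^ 2 * ((12 * (n : ℂ) + 11) / 6) ^ 2 * E₄ τ := by
  have hu := analyticAt_stieltjesForm x τ
  have hprim : ∀ᶠ z in 𝓝 (τ : ℂ), HasDerivAt h (((stieltjesForm x ∘ ofComplex) z ^ 2)⁻¹) z := by
    filter_upwards [(analyticAt_fForm hτ).eventually_analyticAt,
      isOpen_upperHalfPlaneSet.mem_nhds τ.im_pos] with z hz hzℍ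
    simpa only [fForm_comp_ofComplex] using hh.2 z hzℍ hz
  rw [schwarzian_of_hasDerivAt_inv_sq hu (by simpa) hprim, deriv_deriv_of_ramanujan
    (hasDerivAt_stieltjesForm x) (hasDerivAt_serreStieltjesForm hx)]
  simp only [comp_apply, ofComplex_apply]
  field_simp
  ring

lemma tendsto_schwarzian_of_isIntegralOf_fForm (hx : IsSolution 8 9 12 x) {h : ℂ → ℂ}
    (hh : IsIntegralOf h (fForm x ∘ ofComplex)) (τ : ℍ) :
    Tendsto (schwarzian h) (𝓝[≠] (τ : ℂ))
      (𝓝 (2 * (Real.pi : ℂ) ^ 2 * ((12 * (n : ℂ) + 11) / 6) ^ 2 * E₄ τ)) := by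
  have hE := ((hasDerivAt_E₄ τ).continuousAt.continuousWithinAt (s := {(τ : ℂ)}ᶜ)).tendsto.const_mul
    (2 * (Real.pi : ℂ) ^ 2 * ((12 * (n : ℂ) + 11) / 6) ^ 2)
  simp only [comp_apply, ofComplex_apply] at hE
  refine hE.congr' ?_
  filter_upwards [eventually_stieltjesForm_ne_zero hx τ,
    mem_nhdsWithin_of_mem_nhds (isOpen_upperHalfPlaneSet.mem_nhds τ.im_pos)] with z hz hzℍ
  simpa [ofComplex_apply_of_im_pos hzℍ] using
    (schwarzian_eq_of_isIntegralOf_fForm hx hh (τ := ofComplex z) hz).symm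

end FForm

end ModularODE

end

open ModularODE

theorem theorem3p3 (n : ℕ) (x : Fin n → ℝ) (hx : ∀ i, x i ∈ Set.Ioo (0 : ℝ) 1)
    (hsol : ModularODE.IsSolution 8 9 12 x)
    (w : Fin n → UpperHalfPlane) (hw : ∀ i, ModularODE.kleinJ (w i) = (x i : ℂ)) :
    -- the second expression of the form
    (∀ τ : UpperHalfPlane, ModularODE.fForm x τ =
      ModularForm.eta τ ^ 20 / (1728 * (ModularForm.E₄ τ ^ 2 * (ModularODE.kleinJ τ - 1) *
        ∏ i, (ModularODE.kleinJ τ - (x i : ℂ)) ^ 2))) ∧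
    -- weight 2 modular form with a character
    (∃ χ : SL(2, ℤ) →* ℂˣ, ModularODE.IsMeromorphicModularForm 2 χ (ModularODE.fForm x)) ∧
    -- double poles with zero residue at `i`, `ρ`, the `wᵢ` and their translates
    (∀ τ ∈ ModularODE.poleSet w,
      ModularODE.HasDoublePoleZeroResidueAt (ModularODE.fForm x ∘ UpperHalfPlane.ofComplex) τ) ∧
    -- holomorphic and nonvanishing everywhere else
    (∀ τ : UpperHalfPlane, τ ∉ ModularODE.poleSet w →
      AnalyticAt ℂ (ModularODE.fForm x ∘ UpperHalfPlane.ofComplex) τ ∧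
        ModularODE.fForm x τ ≠ 0) ∧
    -- it has an integral on the upper half-plane
    (∃ h : ℂ → ℂ,
      ModularODE.IsIntegralOf h (ModularODE.fForm x ∘ UpperHalfPlane.ofComplex)) ∧
    -- the Schwarz derivative of its integral (holomorphic at the poles as well)
    (∀ h : ℂ → ℂ,
      ModularODE.IsIntegralOf h (ModularODE.fForm x ∘ UpperHalfPlane.ofComplex) →
      (∀ τ : UpperHalfPlane, τ ∉ ModularODE.poleSet w →
        ModularODE.schwarzian h τ =
          2 * (Real.pi : ℂ) ^ 2 * ((12 * (n : ℂ) + 11) / 6) ^ 2 * ModularForm.E₄ τ) ∧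
      (∀ τ : UpperHalfPlane,
        Tendsto (ModularODE.schwarzian h) (𝓝[≠] (τ : ℂ))
          (𝓝 (2 * (Real.pi : ℂ) ^ 2 * ((12 * (n : ℂ) + 11) / 6) ^ 2 *
            ModularForm.E₄ τ)))) := by
  have hmem := mem_poleSet_iff hw
  have hne : ∀ {τ}, τ ∉ poleSet w → stieltjesForm x τ ≠ 0 := fun hτ h0 ↦ hτ ((hmem _).mpr h0)
  exact ⟨fForm_eq_eta_pow_div x, exists_isMeromorphicModularForm_fForm x,
    fun τ hτ ↦ hasDoublePoleZeroResidueAt_fForm hsol ((hmem τ).mp hτ),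
    fun τ hτ ↦ ⟨analyticAt_fForm (hne hτ), fForm_ne_zero (hne hτ)⟩,
    exists_isIntegralOf_fForm hsol, fun h hh ↦
      ⟨fun τ hτ ↦ schwarzian_eq_of_isIntegralOf_fForm hsol hh (hne hτ),
        tendsto_schwarzian_of_isIntegralOf_fForm hsol hh⟩⟩
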